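/- Let $\Theta\subset\mathbb{R}^d$ be compact, and for $\theta\in\Theta$ let $f_\theta:[0,\infty)^{\{1,2,\dots\}}\to[0,\infty)$ be measurable, with $\theta\mapsto f_\theta(y)$ continuous on $\Theta$ for every $y$ (in particular, it may be twice continuously differentiable). Let $Y=(Y_t)_{t\in\mathbb{Z}}$ be a process with values in $\{0,1,2,\dots\}$, put $\mathcal{F}_t=\sigma(Y_s,\,s\le t)$, and let $k^*\in\mathbb{Z}$ and $\theta^*$ in the interior of $\Theta$ be such that $$Y_t\mid\mathcal{F}_{t-1}\sim\mathrm{Poisson}(\lambda_t),\qquad \lambda_t=f_{\theta^*}(Y_{t-1},Y_{t-2},\dots),\qquad\text{for all } t>k^*.$$ The law of $(Y_t)_{t\le k^*}$ is arbitrary, except that for every $r\ge1$ there is $C_r$ with $\mathbb{E}\,Y_t^r\le C_r$ for all $t\le k^*$. Assume: * $D(\Theta)$: there is $\underline{c}>0$ with $f_\theta(y)\ge\underline{c}$ for all $\theta\in\Theta$ and all $y$. * $\mathrm{Id}(\Theta)$: for all $\theta,\theta'\in\Theta$, if $f_\theta(Y_{t-1},Y_{t-2},\dots)=f_{\theta'}(Y_{t-1},Y_{t-2},\dots)$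 almost surely for some $t>k^*$, then $\theta=\theta'$. * $A_0(\Theta)$: $\sup_{\theta\in\Theta}f_\theta(0)<\infty$, and there are $\alpha^{(0)}_j\ge0$ with $\sum_{j\ge1}\alpha^{(0)}_j<1$ and $$\sup_{\theta\in\Theta}|f_\theta(y)-f_\theta(y')|\le\sum_{j\ge1}\alpha^{(0)}_j|y_j-y'_j|\in[0,\infty]\quad\text{for all } y,y'.$$ * $\alpha^{(0)}_j=O(j^{-\gamma})$ for some $\gamma>3/2$. For $n\ge0$ let $T_n=\{k^*+1,\dots,k^*+n\}$ and $$\widehat L_n(\theta)=\sum_{t\in T_n}\big(Y_t\log\widehat\lambda_t(\theta)-\widehat\lambda_t(\theta)\big),\qquad \widehat\lambda_t(\theta)=f_\theta(Y_{t-1},\dots,Y_{k^*+1},0,0,\dots).$$ Then $\widehat L_n$ always attains its maximum over $\Theta$, and for every choice of conditional maximum likelihood estimators $\widehat\theta_n$, that is, $\widehat\theta_n\in\arg\max_{\theta\in\Theta}\widehat L_n(\theta)$ almost surely for each $n$, one has $\widehat\theta_n\to\theta^*$ almost surely as $n\to\infty$. (For $k^*=0$, $\widehat\theta_n$ is $\widehat\theta(T_{1,n})$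 with $T_{1,n}=\{1,\dots,n\}$.) -/

import Mathlib

open scoped NNReal ENNReal

noncomputable section

namespace PoissonAR

/-- A family of conditional-mean functions `θ ↦ f_θ`, where `f_θ` maps a sequence
`(y_1, y_2, …)` of non-negative reals to a non-negative real.
Sequences indexed by `1, 2, 3, …` are indexed by `ℕ` here, with `y j` standing for `y_{j+1}`. -/
abbrev MeanFamily (d : ℕ) : Type := EuclideanSpace ℝ (Fin d) → (ℕ → ℝ≥0) → ℝ≥0

variable {d : ℕ} {Ω : Type*}

/-- The whole past `(Y_{t-1}, Y_{t-2}, …)` of the process at time `t`. -/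
def past (Y : ℤ → Ω → ℕ) (t : ℤ) (ω : Ω) : ℕ → ℝ≥0 :=
  fun j => (Y (t - 1 - (j : ℤ)) ω : ℝ≥0)

/-- The observed past `(Y_{t-1}, …, Y_{k+1}, 0, 0, …)` at time `t`: every value at a time
`≤ k` is replaced by `0`. -/
def observedPast (Y : ℤ → Ω → ℕ) (k t : ℤ) (ω : Ω) : ℕ → ℝ≥0 :=
  fun j => if k < t - 1 - (j : ℤ) then (Y (t - 1 - (j : ℤ)) ω : ℝ≥0) else 0

/-- The σ-field `F_t = σ(Y_s, s ≤ t)`. -/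
@[reducible] def sigmaPast (Y : ℤ → Ω → ℕ) (t : ℤ) : MeasurableSpace Ω :=
  ⨆ s : {s : ℤ // s ≤ t}, MeasurableSpace.comap (Y s) ⊤

/-- Conditionally on the σ-field `m`, the count variable `X` is Poisson with the random mean `lam`:
`P(X = n | m) = e^{-lam} lam^n / n!` almost surely, for every `n`. -/
def CondPoisson [MeasurableSpace Ω] (μ : MeasureTheory.Measure Ω) (m : MeasurableSpace Ω)
    (X : Ω → ℕ) (lam : Ω → ℝ≥0) : Prop :=
  ∀ n : ℕ, MeasureTheory.condExp m μ (Set.indicator {ω | X ω = n} (fun _ => (1 : ℝ)))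
    =ᵐ[μ] fun ω => Real.exp (-(lam ω : ℝ)) * (lam ω : ℝ) ^ n / (n.factorial : ℝ)

/-- After time `k` the process is Poisson autoregressive with parameter `θs`:
`Y_t | F_{t-1} ∼ Poisson(f_{θs}(Y_{t-1}, Y_{t-2}, …))` for all `t > k`. Nothing is said about
the law of `(Y_t)_{t ≤ k}`. -/
def IsPoissonARAfter [MeasurableSpace Ω] (μ : MeasureTheory.Measure Ω) (Y : ℤ → Ω → ℕ)
    (k : ℤ) (f : MeanFamily d) (θs : EuclideanSpace ℝ (Fin d)) : Prop :=
  ∀ t : ℤ, k < t →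
    CondPoisson μ (sigmaPast Y (t - 1)) (Y t) (fun ω => f θs (past Y t ω))

/-- Assumption `A_0(Θ)` with Lipschitz coefficients `α` (`α j` stands for `α_{j+1}`):
`sup_Θ f_θ(0) < ∞`, `∑ α_j < 1`, and
`sup_Θ |f_θ(y) - f_θ(y')| ≤ ∑ α_j |y_j - y'_j|` for all `y, y'`.
The sums are taken in `[0, ∞]`, so the last condition is void where its right side is infinite. -/
structure AssumptionA0 (Θ : Set (EuclideanSpace ℝ (Fin d))) (f : MeanFamily d)
    (α : ℕ → ℝ≥0) : Prop where
  bounded_zero : ∃ C : ℝ≥0, ∀ θ ∈ Θ, f θ 0 ≤ C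
  sum_lt_one : ∑' j : ℕ, (α j : ℝ≥0∞) < 1
  lipschitz : ∀ θ ∈ Θ, ∀ y y' : ℕ → ℝ≥0,
    edist (f θ y) (f θ y') ≤ ∑' j : ℕ, (α j : ℝ≥0∞) * edist (y j) (y' j)

/-- Assumption `D(Θ)`: the functions `f_θ`, `θ ∈ Θ`, are bounded below by one positive constant. -/
def AssumptionD (Θ : Set (EuclideanSpace ℝ (Fin d))) (f : MeanFamily d) : Prop :=
  ∃ c : ℝ≥0, 0 < c ∧ ∀ θ ∈ Θ, ∀ y : ℕ → ℝ≥0, c ≤ f θ y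

/-- Assumption `Id(Θ)`: for `θ, θ' ∈ Θ`, if `f_θ(Y_{t-1}, …) = f_{θ'}(Y_{t-1}, …)` a.s. for some
`t > k`, then `θ = θ'`. -/
def AssumptionId [MeasurableSpace Ω] (μ : MeasureTheory.Measure Ω) (Y : ℤ → Ω → ℕ) (k : ℤ)
    (Θ : Set (EuclideanSpace ℝ (Fin d))) (f : MeanFamily d) : Prop :=
  ∀ θ ∈ Θ, ∀ θ' ∈ Θ,
    (∃ t : ℤ, k < t ∧ ∀ᵐ ω ∂μ, f θ (past Y t ω) = f θ' (past Y t ω)) → θ = θ'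

/-- Uniformly bounded moments of every order up to time `k`:
for every `r ≥ 1` there is `C_r` with `E Y_t^r ≤ C_r` for all `t ≤ k`. -/
def BoundedPastMoments [MeasurableSpace Ω] (μ : MeasureTheory.Measure Ω) (Y : ℤ → Ω → ℕ)
    (k : ℤ) : Prop :=
  ∀ r : ℕ, 1 ≤ r → ∃ C : ℝ≥0, ∀ t : ℤ, t ≤ k → ∫⁻ ω, (Y t ω : ℝ≥0∞) ^ r ∂μ ≤ C

/-- The approximated conditional mean `λ̂_t(θ) = f_θ(Y_{t-1}, …, Y_{k+1}, 0, …)`. -/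
def lamHat (Y : ℤ → Ω → ℕ) (k : ℤ) (f : MeanFamily d) (t : ℤ)
    (θ : EuclideanSpace ℝ (Fin d)) (ω : Ω) : ℝ :=
  (f θ (observedPast Y k t ω) : ℝ)

/-- The approximated conditional log-likelihood, up to a constant, computed on a segment `T`:
`L̂(T, θ) = ∑_{t ∈ T} (Y_t log λ̂_t(θ) - λ̂_t(θ))`. -/
def logLikHat (Y : ℤ → Ω → ℕ) (k : ℤ) (f : MeanFamily d) (T : Finset ℤ)
    (θ : EuclideanSpace ℝ (Fin d)) (ω : Ω) : ℝ :=
  ∑ t ∈ T, ((Y t ω : ℝ) * Real.log (lamHat Y k f t θ ω) - lamHat Y k f t θ ω)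

/-- The set `argmax_{θ ∈ Θ} L̂(T, θ)` of conditional maximum likelihood estimates on `T`. -/
def mleSet (Y : ℤ → Ω → ℕ) (k : ℤ) (Θ : Set (EuclideanSpace ℝ (Fin d))) (f : MeanFamily d)
    (T : Finset ℤ) (ω : Ω) : Set (EuclideanSpace ℝ (Fin d)) :=
  {θ | θ ∈ Θ ∧ ∀ θ' ∈ Θ, logLikHat Y k f T θ' ω ≤ logLikHat Y k f T θ ω}

end PoissonAR

end

/-!
The conditional log-likelihood ratio between the true parameter `θs` and another parameter `θ` is
the sum over time of the Kullback–Leibler divergences of the predicted Poisson laws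
(`predictiveDiv`), plus a martingale, plus an error due to replacing the unobserved past by zeros.
Consistency follows once the martingale and the error are `o(n)` uniformly in `θ`, while the
divergences add up to at least a positive multiple of `n` uniformly outside each neighbourhood of
`θs` (`TypicalPath.eventually_pathLogLik_lt`).

The process is not assumed stationary, and no ergodic theorem is used. Everything is deduced from
laws of large numbers along countably many predictable events, which hold almost surely and are
collected in `TypicalPath`. They come from a law of large numbers for `L²`-bounded martingale
differences (`tendsto_average_of_martingaleDifference`) and from the boundedness of all moments
(`exists_moment_bound`). Both this boundedness and its pathwise analogue
(`TypicalPath.exists_sum_cube_le`) rest on Jensen's inequality, the Lipschitz weights having total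
mass below one. The rest of the argument is deterministic, for a fixed typical path.

* The martingale part. By the Lipschitz condition, the observed past may be replaced by its last `m`
  values, capped at `K`, at the cost of a small fraction of `n`. Capped pasts take finitely many
  values, so that uniformity in `θ` is immediate
  (`TypicalPath.eventually_abs_sum_mul_log_le`).
* The unobserved past. Its influence at time `k + 1 + i` is `∑ α (i + j) Y (k - j)`, which tends to
  zero almost surely by dominated convergence, as `α j = O((j + 1) ^ (-γ))` with `γ > 1`
  (`tendsto_condMean_sub_observed`).
* The divergence. If `θ ≠ θs`, identifiability provides a finite word on which the conditional
  means of `θ` and `θs` differ (`exists_word_ne`). As the conditional means are bounded below, every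
  finite word, preceded by a long run of zeros, is observed with positive frequency
  (`TypicalPath.exists_pattern_frequency`), and each occurrence contributes at least a fixed amount
  to the divergence, uniformly near `θ`. Compactness of the parameter set concludes.
-/

namespace PoissonAR

open MeasureTheory Filter Topology Finset

/-! ### Law of large numbers for martingale differences -/

section

/-- **Kronecker's lemma** for the weights `1 / (i + 1)`: summation by parts writes the average of
`x` as the last partial sum minus the Cesàro mean of all of them. -/
lemma tendsto_average_zero_of_tendsto_weighted_sum {x : ℕ → ℝ} {l : ℝ}
    (h : Tendsto (fun n => ∑ i ∈ range n, x i / ((i : ℝ) + 1)) atTop (𝓝 l)) :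
    Tendsto (fun n : ℕ => (∑ i ∈ range n, x i) / (n : ℝ)) atTop (𝓝 0) := by
  set M : ℕ → ℝ := fun n => ∑ i ∈ range n, x i / ((i : ℝ) + 1) with hM
  have key : ∀ n : ℕ, ∑ i ∈ range n, x i = n * M n - ∑ i ∈ range n, M i := by
    intro n
    induction n with
    | zero => simp
    | succ n ih =>
      have h1 : M (n + 1) = M n + x n / ((n : ℝ) + 1) := by simp [hM, sum_range_succ]
      have h2 : ((n : ℝ) + 1) * (x n / ((n : ℝ) + 1)) = x n := by field_simp
      rw [sum_range_succ, sum_range_succ, ih, h1]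
      push_cast
      linear_combination -h2
  have hc := h.sub h.cesaro
  rw [sub_self] at hc
  refine hc.congr' ?_
  filter_upwards [eventually_gt_atTop 0] with n hn
  have : (n : ℝ) ≠ 0 := by positivity
  rw [key n]
  field_simp

variable {Ω : Type*} {m0 : MeasurableSpace Ω} {μ : Measure Ω}

/-- Strong law of large numbers for martingale differences that are bounded in `L²`: the martingale
`∑ X i / (i + 1)` is bounded in `L²`, hence converges almost surely, and Kronecker's lemma
applies. -/
theorem tendsto_average_of_martingaleDifference [IsProbabilityMeasure μ] {ℱ : Filtration ℕ m0}
    {X : ℕ → Ω → ℝ} {C : ℝ} (hmeas : ∀ i, StronglyMeasurable[ℱ (i + 1)] (X i))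
    (hL2 : ∀ i, MemLp (X i) 2 μ) (hC : ∀ i, ∫ ω, X i ω ^ 2 ∂μ ≤ C)
    (h0 : ∀ i, μ[X i|ℱ i] =ᵐ[μ] 0) :
    ∀ᵐ ω ∂μ, Tendsto (fun n : ℕ => (∑ i ∈ range n, X i ω) / (n : ℝ)) atTop (𝓝 0) := by
  set M : ℕ → Ω → ℝ := fun n ω => ∑ i ∈ range n, X i ω / ((i : ℝ) + 1) with hM
  have hMsucc : ∀ n, M (n + 1) = M n + fun ω => X n ω / ((n : ℝ) + 1) := by
    intro n; ext ω; simp [hM, sum_range_succ]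
  have hXdiv : ∀ n : ℕ, MemLp (fun ω => X n ω / ((n : ℝ) + 1)) 2 μ := by
    intro n
    simpa [div_eq_inv_mul] using (hL2 n).const_mul (((n : ℝ) + 1)⁻¹)
  have hML2 : ∀ n, MemLp (M n) 2 μ := by
    intro n
    exact memLp_finsetSum _ fun i _ => hXdiv i
  have hMmeas : ∀ n, StronglyMeasurable[ℱ n] (M n) := by
    intro n
    refine Finset.stronglyMeasurable_fun_sum _ fun i hi => ?_
    have : StronglyMeasurable[ℱ n] (X i) := (hmeas i).mono (ℱ.mono (mem_range.1 hi))
    simpa [div_eq_mul_inv] using this.mul_const (((i : ℝ) + 1)⁻¹)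
  have hcond : ∀ n, μ[fun ω => X n ω / ((n : ℝ) + 1)|ℱ n] =ᵐ[μ] 0 := by
    intro n
    have h1 : (fun ω => X n ω / ((n : ℝ) + 1)) = ((n : ℝ) + 1)⁻¹ • X n := by
      ext ω; simp [div_eq_inv_mul]
    rw [h1]
    filter_upwards [condExp_smul (((n : ℝ) + 1)⁻¹) (X n) (ℱ n) (μ := μ), h0 n] with ω h2 h3
    simp [h2, h3]
  have hmart : Martingale M ℱ μ := by
    refine martingale_of_condExp_sub_eq_zero_nat (fun n => hMmeas n)
      (fun n => (hML2 n).integrable one_le_two) fun n => ?_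
    rw [hMsucc, add_sub_cancel_left]
    exact hcond n
  have hcross : ∀ n, ∫ ω, M n ω * (X n ω / ((n : ℝ) + 1)) ∂μ = 0 := by
    intro n
    have hint : Integrable (M n * fun ω => X n ω / ((n : ℝ) + 1)) μ :=
      (hML2 n).integrable_mul (hXdiv n)
    have h1 := condExp_mul_of_stronglyMeasurable_left (hMmeas n) hint
      ((hXdiv n).integrable one_le_two)
    have h2 : ∫ ω, (M n * fun ω => X n ω / ((n : ℝ) + 1)) ω ∂μ = 0 := by
      rw [← integral_condExp (ℱ.le n), integral_congr_ae (h1.trans ?_)]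
      · exact integral_zero _ _
      filter_upwards [hcond n] with ω hω
      simp [hω]
    exact h2
  have hC0 : 0 ≤ C := (integral_nonneg fun ω => sq_nonneg (X 0 ω)).trans (hC 0)
  have hsq : ∀ n, ∫ ω, M n ω ^ 2 ∂μ ≤ ∑ i ∈ range n, C * (1 / ((i : ℝ) + 1) ^ 2) := by
    intro n
    induction n with
    | zero => simp [hM]
    | succ n ih =>
      have e1 : ∀ ω, M (n + 1) ω ^ 2 = M n ω ^ 2 + 2 * (M n ω * (X n ω / ((n : ℝ) + 1)))
          + X n ω ^ 2 * (1 / ((n : ℝ) + 1) ^ 2) := by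
        intro ω
        rw [hMsucc]
        simp only [Pi.add_apply]
        field_simp
        ring
      have i1 := (hML2 n).integrable_sq
      have i2 : Integrable (fun ω => 2 * (M n ω * (X n ω / ((n : ℝ) + 1)))) μ :=
        ((hML2 n).integrable_mul (hXdiv n)).const_mul 2
      have i3 : Integrable (fun ω => X n ω ^ 2 * (1 / ((n : ℝ) + 1) ^ 2)) μ :=
        (hL2 n).integrable_sq.mul_const _
      have e2 : ∫ ω, M (n + 1) ω ^ 2 ∂μ = ∫ ω, M n ω ^ 2 ∂μ
          + ∫ ω, 2 * (M n ω * (X n ω / ((n : ℝ) + 1))) ∂μ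
          + ∫ ω, X n ω ^ 2 * (1 / ((n : ℝ) + 1) ^ 2) ∂μ := by
        have i12 : Integrable (fun ω => M n ω ^ 2 + 2 * (M n ω * (X n ω / ((n : ℝ) + 1)))) μ :=
          i1.add i2
        rw [← integral_add i1 i2, ← integral_add i12 i3]
        exact integral_congr_ae (Eventually.of_forall e1)
      rw [e2, integral_const_mul, hcross n, integral_mul_const, sum_range_succ]
      have := mul_le_mul_of_nonneg_right (hC n)
        (by positivity : (0 : ℝ) ≤ 1 / ((n : ℝ) + 1) ^ 2)
      linarith
  have hsum : Summable fun i : ℕ => C * (1 / ((i : ℝ) + 1) ^ 2) := by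
    have := (summable_nat_add_iff 1).2 (Real.summable_one_div_nat_pow.2 one_lt_two)
    simpa using this.mul_left C
  set S := ∑' i : ℕ, C * (1 / ((i : ℝ) + 1) ^ 2)
  have hbdd : ∀ n, eLpNorm (M n) 1 μ ≤ ((1 + S).toNNReal : ℝ≥0) := by
    intro n
    rw [eLpNorm_one_eq_lintegral_enorm, ← ofReal_integral_norm_eq_lintegral_enorm
      ((hML2 n).integrable one_le_two)]
    refine ENNReal.ofReal_le_ofReal ?_
    have h1 : ∫ ω, ‖M n ω‖ ∂μ ≤ ∫ ω, (1 + M n ω ^ 2) ∂μ := by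
      refine integral_mono ((hML2 n).integrable one_le_two).norm
        ((integrable_const _).add (hML2 n).integrable_sq) fun ω => ?_
      simp only [Real.norm_eq_abs]
      nlinarith [sq_nonneg (|M n ω| - 1), sq_abs (M n ω), sq_nonneg (M n ω)]
    rw [integral_add (integrable_const _) (hML2 n).integrable_sq] at h1
    have h2 : ∑ i ∈ range n, C * (1 / ((i : ℝ) + 1) ^ 2) ≤ S :=
      hsum.sum_le_tsum _ fun i _ => by positivity
    have h3 := hsq n
    simp only [integral_const, probReal_univ, smul_eq_mul, mul_one] at h1
    linarith
  filter_upwards [hmart.submartingale.exists_ae_tendsto_of_bdd hbdd] with ω ⟨l, hl⟩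
  exact tendsto_average_zero_of_tendsto_weighted_sum hl

end

/-! ### Conditionally Poisson variables -/

section

/-- The Poisson weight `P(X = n)` for `X ∼ Poisson(a)`, with a real parameter `a`, in the form in
which it occurs in `CondPoisson`. -/
noncomputable def poissonWeight (a : ℝ) (n : ℕ) : ℝ := Real.exp (-a) * a ^ n / (n.factorial : ℝ)

lemma poissonWeight_nonneg {a : ℝ} (ha : 0 ≤ a) (n : ℕ) : 0 ≤ poissonWeight a n := by
  unfold poissonWeight; positivity

lemma hasSum_poissonWeight (a : ℝ) : HasSum (poissonWeight a) 1 := by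
  have h := (NormedSpace.expSeries_div_hasSum_exp (𝔸 := ℝ) a).mul_left (Real.exp (-a))
  rw [← Real.exp_eq_exp_ℝ, ← Real.exp_add, neg_add_cancel, Real.exp_zero] at h
  exact h.congr_fun fun n => mul_div_assoc _ _ _

lemma poissonWeight_le_one {a : ℝ} (ha : 0 ≤ a) (n : ℕ) : poissonWeight a n ≤ 1 :=
  le_hasSum (hasSum_poissonWeight a) n fun i _ => poissonWeight_nonneg ha i

lemma measurable_poissonWeight (n : ℕ) : Measurable fun a : ℝ => poissonWeight a n := by
  unfold poissonWeight; fun_prop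

/-- The factorial moments of the Poisson law are the powers of its mean. -/
lemma tsum_descFactorial_mul_poissonWeight (a : ℝ≥0) (q : ℕ) :
    ∑' n : ℕ, (n.descFactorial q : ℝ≥0∞) * ENNReal.ofReal (poissonWeight a n) = (a : ℝ≥0∞) ^ q := by
  have hshift : HasSum (fun n : ℕ => ((n + q).descFactorial q : ℝ) * poissonWeight a (n + q))
      ((a : ℝ) ^ q) := by
    have h := (hasSum_poissonWeight a).mul_left ((a : ℝ) ^ q)
    rw [mul_one] at h
    refine h.congr_fun ?_
    intro n
    have h1 : ((n + q).factorial : ℝ) = (n.factorial : ℝ) * ((n + q).descFactorial q : ℝ) := by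
      have := Nat.factorial_mul_descFactorial (Nat.le_add_left q n)
      rw [Nat.add_sub_cancel] at this
      exact_mod_cast this.symm
    have h2 : ((n + q).descFactorial q : ℝ) ≠ 0 := by
      have := (Nat.descFactorial_pos (n := n + q) (k := q)).2 (Nat.le_add_left q n)
      positivity
    have h3 : (n.factorial : ℝ) ≠ 0 := by positivity
    simp only [poissonWeight]
    rw [h1]
    field_simp
    ring
  have hfull : HasSum (fun n : ℕ => (n.descFactorial q : ℝ) * poissonWeight a n) ((a : ℝ) ^ q) := by
    rw [← hasSum_nat_add_iff' q]
    have : ∑ i ∈ range q, (i.descFactorial q : ℝ) * poissonWeight a i = 0 := by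
      refine sum_eq_zero fun i hi => ?_
      rw [Nat.descFactorial_eq_zero_iff_lt.2 (mem_range.1 hi)]
      simp
    rw [this, sub_zero]
    exact hshift
  have hnn : ∀ n : ℕ, 0 ≤ (n.descFactorial q : ℝ) * poissonWeight a n := fun n =>
    mul_nonneg (Nat.cast_nonneg _) (poissonWeight_nonneg a.coe_nonneg n)
  have h := ENNReal.ofReal_tsum_of_nonneg hnn hfull.summable
  rw [hfull.tsum_eq] at h
  rw [ENNReal.ofReal_pow a.coe_nonneg, ENNReal.ofReal_coe_nnreal] at h
  rw [h]
  refine tsum_congr fun n => ?_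
  rw [ENNReal.ofReal_mul (Nat.cast_nonneg _), ENNReal.ofReal_natCast]

variable {Ω : Type*} {m m0 : MeasurableSpace Ω} {μ : Measure Ω}

/-- Conditioning a function of a conditionally Poisson variable, in integrated form. -/
lemma CondPoisson.setLIntegral_comp [IsProbabilityMeasure μ] (hm : m ≤ m0)
    {X : Ω → ℕ} (hX : Measurable X) {lam : Ω → ℝ≥0} (hlam : Measurable[m] lam)
    (h : CondPoisson μ m X lam) (g : ℕ → ℝ≥0∞) {s : Set Ω} (hs : MeasurableSet[m] s) :
    ∫⁻ ω in s, g (X ω) ∂μ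
      = ∫⁻ ω in s, ∑' n, g n * ENNReal.ofReal (poissonWeight (lam ω) n) ∂μ := by
  have hlam0 : Measurable lam := hlam.mono hm le_rfl
  have hwm : ∀ n : ℕ, Measurable fun ω => poissonWeight (lam ω) n := fun n =>
    (measurable_poissonWeight n).comp (measurable_coe_nnreal_real.comp hlam0)
  have hset : ∀ n : ℕ, MeasurableSet {ω | X ω = n} := fun n => hX (measurableSet_singleton n)
  have e1 : ∀ ω, g (X ω) = ∑' n, g n * Set.indicator {ω | X ω = n} (fun _ => (1 : ℝ≥0∞)) ω := by
    intro ω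
    rw [tsum_eq_single (X ω)]
    · simp
    · intro n hn
      simp [Set.indicator, hn.symm]
  simp_rw [e1]
  rw [lintegral_tsum, lintegral_tsum]
  · refine tsum_congr fun n => ?_
    rw [lintegral_const_mul, lintegral_const_mul]
    · congr 1
      have hint : Integrable (Set.indicator {ω | X ω = n} (fun _ => (1 : ℝ))) μ :=
        (integrable_const _).indicator (hset n)
      have h1 := setIntegral_condExp hm hint hs
      rw [setIntegral_congr_ae (hm _ hs) ((h n).mono fun ω hω _ => hω)] at h1
      have h2 : ∫ ω in s, poissonWeight (lam ω) n ∂μ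
          = ∫ ω in s, Set.indicator {ω | X ω = n} (fun _ => (1 : ℝ)) ω ∂μ := h1
      have i1 : IntegrableOn (fun ω => poissonWeight (lam ω) n) s μ := by
        refine Integrable.integrableOn (Integrable.of_bound (hwm n).aestronglyMeasurable 1
          (Eventually.of_forall fun ω => ?_))
        rw [Real.norm_eq_abs, abs_of_nonneg (poissonWeight_nonneg (lam ω).coe_nonneg n)]
        exact poissonWeight_le_one (lam ω).coe_nonneg n
      rw [← ofReal_integral_eq_lintegral_ofReal i1
        (Eventually.of_forall fun ω => poissonWeight_nonneg (lam ω).coe_nonneg n), h2,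
        ofReal_integral_eq_lintegral_ofReal hint.integrableOn
        (Eventually.of_forall fun ω => Set.indicator_nonneg (fun _ _ => zero_le_one) ω)]
      refine lintegral_congr fun ω => ?_
      by_cases hω : X ω = n <;> simp [Set.indicator, hω]
    · exact (hwm n).ennreal_ofReal
    · exact measurable_const.indicator (hset n)
  · exact fun n => ((hwm n).ennreal_ofReal.const_mul _).aemeasurable
  · exact fun n => ((measurable_const.indicator (hset n)).const_mul _).aemeasurable

/-- Conditional factorial moments of a conditionally Poisson variable. -/
lemma CondPoisson.setLIntegral_descFactorial [IsProbabilityMeasure μ]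
    (hm : m ≤ m0) {X : Ω → ℕ} (hX : Measurable X) {lam : Ω → ℝ≥0} (hlam : Measurable[m] lam)
    (h : CondPoisson μ m X lam) (q : ℕ) {s : Set Ω} (hs : MeasurableSet[m] s) :
    ∫⁻ ω in s, ((X ω).descFactorial q : ℝ≥0∞) ∂μ = ∫⁻ ω in s, (lam ω : ℝ≥0∞) ^ q ∂μ := by
  rw [h.setLIntegral_comp hm hX hlam (fun n => (n.descFactorial q : ℝ≥0∞)) hs]
  exact lintegral_congr fun ω => tsum_descFactorial_mul_poissonWeight (lam ω) q

lemma CondPoisson.lintegral_descFactorial [IsProbabilityMeasure μ]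
    (hm : m ≤ m0) {X : Ω → ℕ} (hX : Measurable X) {lam : Ω → ℝ≥0} (hlam : Measurable[m] lam)
    (h : CondPoisson μ m X lam) (q : ℕ) :
    ∫⁻ ω, ((X ω).descFactorial q : ℝ≥0∞) ∂μ = ∫⁻ ω, (lam ω : ℝ≥0∞) ^ q ∂μ := by
  simpa using h.setLIntegral_descFactorial hm hX hlam q (MeasurableSet.univ (α := Ω))

lemma CondPoisson.condExp_descFactorial [IsProbabilityMeasure μ]
    (hm : m ≤ m0) {X : Ω → ℕ} (hX : Measurable X) {lam : Ω → ℝ≥0} (hlam : Measurable[m] lam)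
    (h : CondPoisson μ m X lam) (q : ℕ)
    (hint : Integrable (fun ω => ((X ω).descFactorial q : ℝ)) μ) :
    μ[fun ω => ((X ω).descFactorial q : ℝ)|m] =ᵐ[μ] fun ω => (lam ω : ℝ) ^ q := by
  have hlr : Measurable[m] fun ω => (lam ω : ℝ) ^ q :=
    (measurable_coe_nnreal_real.comp hlam).pow_const q
  have e1 : ∀ ω, ENNReal.ofReal ((lam ω : ℝ) ^ q) = (lam ω : ℝ≥0∞) ^ q := fun ω => by
    rw [ENNReal.ofReal_pow (lam ω).coe_nonneg, ENNReal.ofReal_coe_nnreal]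
  have hlint : Integrable (fun ω => (lam ω : ℝ) ^ q) μ := by
    refine ⟨(hlr.mono hm le_rfl).aestronglyMeasurable, ?_⟩
    rw [hasFiniteIntegral_iff_ofReal (Eventually.of_forall fun ω => pow_nonneg (lam ω).coe_nonneg q)]
    simp_rw [e1]
    rw [← h.lintegral_descFactorial hm hX hlam q]
    have := hint.2
    rw [hasFiniteIntegral_iff_ofReal (Eventually.of_forall fun ω => Nat.cast_nonneg _)] at this
    simpa using this
  symm
  refine ae_eq_condExp_of_forall_setIntegral_eq hm hint (fun s _ _ => hlint.integrableOn) ?_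
    hlr.stronglyMeasurable.aestronglyMeasurable
  intro s hs _
  rw [integral_eq_lintegral_of_nonneg_ae (Eventually.of_forall fun ω => pow_nonneg (lam ω).coe_nonneg q)
    (hlr.mono hm le_rfl).aestronglyMeasurable,
    integral_eq_lintegral_of_nonneg_ae (Eventually.of_forall fun ω => Nat.cast_nonneg _)
    hint.1.restrict]
  congr 1
  simp_rw [e1, ENNReal.ofReal_natCast]
  exact (h.setLIntegral_descFactorial hm hX hlam q hs).symm

end

/-! ### Moments of the process -/

section

/-- Jensen's inequality for a power and weights of total mass at most `A < 1`, the missing mass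
being put on the constant term. -/
lemma add_sum_mul_pow_le {ι : Type*} (s : Finset ι) {w x : ι → ℝ} {A C : ℝ} (hw : ∀ i ∈ s, 0 ≤ w i)
    (hx : ∀ i ∈ s, 0 ≤ x i) (hA : A < 1) (hsum : ∑ i ∈ s, w i ≤ A) (hC : 0 ≤ C) (q : ℕ) :
    (C + ∑ i ∈ s, w i * x i) ^ q ≤ (C / (1 - A)) ^ q + ∑ i ∈ s, w i * x i ^ q := by
  set B := 1 - ∑ i ∈ s, w i with hB
  have hB0 : 0 < B := by linarith
  have hB1 : B ≤ 1 := by linarith [sum_nonneg hw]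
  have h := Real.pow_arith_mean_le_arith_mean_pow (Finset.insertNone s)
    (fun o => o.elim B w) (fun o => o.elim (C / B) x) ?_ ?_ ?_ q
  · simp only [Finset.sum_insertNone, Option.elim] at h
    have e : B * (C / B) = C := by field_simp
    rw [e] at h
    refine h.trans (add_le_add ?_ le_rfl)
    have h1 : (C / B) ^ q ≤ (C / (1 - A)) ^ q :=
      pow_le_pow_left₀ (by positivity) (div_le_div_of_nonneg_left hC (by linarith) (by linarith)) q
    have h2 : 0 ≤ (C / B) ^ q := by positivity
    nlinarith
  · intro o ho
    cases o with
    | none => exact hB0.le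
    | some i => exact hw i (Finset.some_mem_insertNone.1 ho)
  · simp [Finset.sum_insertNone, hB]
  · intro o ho
    cases o with
    | none => exact div_nonneg hC hB0.le
    | some i => exact hx i (Finset.some_mem_insertNone.1 ho)

section Weights

variable {d : ℕ} {Θ : Set (EuclideanSpace ℝ (Fin d))} {f : MeanFamily d} {α : ℕ → ℝ≥0}

lemma AssumptionA0.summable (h : AssumptionA0 Θ f α) : Summable α :=
  ENNReal.tsum_coe_ne_top_iff_summable.1 (h.sum_lt_one.trans ENNReal.one_lt_top).ne

lemma AssumptionA0.tsum_lt_one (h : AssumptionA0 Θ f α) : ∑' j, α j < 1 := by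
  have := h.sum_lt_one
  rw [← ENNReal.coe_tsum h.summable] at this
  exact_mod_cast this

lemma AssumptionA0.sum_le_tsum (h : AssumptionA0 Θ f α) (s : Finset ℕ) :
    ∑ j ∈ s, (α j : ℝ) ≤ ((∑' j, α j : ℝ≥0) : ℝ) := by
  have := h.summable.sum_le_tsum s fun _ _ => zero_le
  exact_mod_cast this

lemma edist_zero_nnreal (x : ℝ≥0) : edist x 0 = x := by
  rw [edist_nndist]; simp [NNReal.nndist_zero_eq_val']

lemma le_add_edist_nnreal (x y : ℝ≥0) : (x : ℝ≥0∞) ≤ y + edist x y := by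
  rw [← edist_zero_nnreal x, ← edist_zero_nnreal y, add_comm]
  exact edist_triangle x y 0

/-- The conditional mean grows at most linearly in the past. -/
lemma AssumptionA0.exists_le_add_tsum (h : AssumptionA0 Θ f α) :
    ∃ C : ℝ≥0, ∀ θ ∈ Θ, ∀ y : ℕ → ℝ≥0,
      (f θ y : ℝ≥0∞) ≤ C + ∑' j, (α j : ℝ≥0∞) * (y j : ℝ≥0∞) := by
  obtain ⟨C, hC⟩ := h.bounded_zero
  refine ⟨C, fun θ hθ y => (le_add_edist_nnreal (f θ y) (f θ 0)).trans (add_le_add ?_ ?_)⟩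
  · exact_mod_cast hC θ hθ
  · simpa [edist_zero_nnreal] using h.lipschitz θ hθ y 0

/-- Jensen's inequality for an infinite weighted sum. -/
lemma AssumptionA0.add_tsum_mul_pow_le (h : AssumptionA0 Θ f α) (C : ℝ≥0) (q : ℕ) :
    ∃ K : ℝ≥0, ∀ x : ℕ → ℝ≥0,
      ((C : ℝ≥0∞) + ∑' j, (α j : ℝ≥0∞) * (x j : ℝ≥0∞)) ^ q
        ≤ K + ∑' j, (α j : ℝ≥0∞) * (x j : ℝ≥0∞) ^ q := by
  have hA1 : ((∑' j, α j : ℝ≥0) : ℝ) < 1 := by exact_mod_cast h.tsum_lt_one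
  have hK0 : 0 ≤ ((C : ℝ) / (1 - ((∑' j, α j : ℝ≥0) : ℝ))) ^ q :=
    pow_nonneg (div_nonneg C.coe_nonneg (by linarith)) q
  obtain ⟨K, hK⟩ : ∃ K : ℝ≥0, (K : ℝ) = ((C : ℝ) / (1 - ((∑' j, α j : ℝ≥0) : ℝ))) ^ q :=
    ⟨⟨_, hK0⟩, rfl⟩
  refine ⟨K, fun x => ?_⟩
  have hfin : ∀ s : Finset ℕ, ((C : ℝ≥0∞) + ∑ j ∈ s, (α j : ℝ≥0∞) * (x j : ℝ≥0∞)) ^ q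
      ≤ K + ∑' j, (α j : ℝ≥0∞) * (x j : ℝ≥0∞) ^ q := by
    intro s
    have h1 := add_sum_mul_pow_le s (w := fun j => (α j : ℝ)) (x := fun j => (x j : ℝ))
      (fun j _ => (α j).coe_nonneg) (fun j _ => (x j).coe_nonneg) hA1 (h.sum_le_tsum s)
      C.coe_nonneg q
    have h2 : (C + ∑ j ∈ s, α j * x j) ^ q ≤ K + ∑ j ∈ s, α j * x j ^ q := by
      rw [← NNReal.coe_le_coe]
      push_cast
      rw [hK]
      exact h1
    have h3 : ((C : ℝ≥0∞) + ∑ j ∈ s, (α j : ℝ≥0∞) * (x j : ℝ≥0∞)) ^ q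
        ≤ K + ∑ j ∈ s, (α j : ℝ≥0∞) * (x j : ℝ≥0∞) ^ q := by
      exact_mod_cast h2
    exact h3.trans (add_le_add le_rfl (ENNReal.sum_le_tsum s))
  have hlim : Tendsto (fun s : Finset ℕ =>
      ((C : ℝ≥0∞) + ∑ j ∈ s, (α j : ℝ≥0∞) * (x j : ℝ≥0∞)) ^ q) atTop
      (𝓝 (((C : ℝ≥0∞) + ∑' j, (α j : ℝ≥0∞) * (x j : ℝ≥0∞)) ^ q)) :=
    ((ENNReal.continuous_pow q).tendsto _).comp
      (tendsto_const_nhds.add ENNReal.summable.hasSum)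
  exact le_of_tendsto' hlim hfin

end Weights

section Past

variable {Ω : Type*} {Y : ℤ → Ω → ℕ}

lemma sigmaPast_mono : Monotone (sigmaPast Y) := fun _ t hst =>
  iSup_le fun r => le_iSup (fun s : {s : ℤ // s ≤ t} => MeasurableSpace.comap (Y s) ⊤)
    ⟨r.1, r.2.trans hst⟩

lemma measurable_sigmaPast {s t : ℤ} (hst : s ≤ t) : Measurable[sigmaPast Y t] (Y s) :=
  (comap_measurable (Y s)).mono
    (le_iSup (fun s : {s : ℤ // s ≤ t} => MeasurableSpace.comap (Y s) ⊤) ⟨s, hst⟩) le_rfl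

lemma measurable_past (t : ℤ) : Measurable[sigmaPast Y (t - 1)] (past Y t) := by
  refine (@measurable_pi_iff _ _ _ (sigmaPast Y (t - 1)) _ _).2 fun j => ?_
  exact (measurable_from_top (f := fun n : ℕ => (n : ℝ≥0))).comp
    (measurable_sigmaPast (by omega : t - 1 - (j : ℤ) ≤ t - 1))

end Past

section CountProcess

variable {d : ℕ} {Ω : Type*} [mΩ : MeasurableSpace Ω] {μ : Measure Ω} {Y : ℤ → Ω → ℕ} {k : ℤ}
  {Θ : Set (EuclideanSpace ℝ (Fin d))} {f : MeanFamily d} {θs : EuclideanSpace ℝ (Fin d)}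
  {α : ℕ → ℝ≥0}

lemma sigmaPast_le (hY : ∀ t, Measurable (Y t)) (t : ℤ) : sigmaPast Y t ≤ mΩ :=
  iSup_le fun s => (hY s).comap_le

/-- All moments of the process are bounded, also after time `k`. The bound propagates through
`E (Y_t - q)₊ ^ q ≤ E Y_t (Y_t - 1) ⋯ (Y_t - q + 1) = E λ_t ^ q` and Jensen's inequality for the
weights `α`, whose total mass is below one. -/
theorem exists_moment_bound [IsProbabilityMeasure μ] (hY : ∀ t, Measurable (Y t))
    (hf : Measurable (f θs)) (hθs : θs ∈ Θ) (hmodel : IsPoissonARAfter μ Y k f θs)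
    (hmom : BoundedPastMoments μ Y k) (hA0 : AssumptionA0 Θ f α) (q : ℕ) :
    ∃ C : ℝ≥0, ∀ t : ℤ, ∫⁻ ω, (Y t ω : ℝ≥0∞) ^ q ∂μ ≤ C := by
  rcases Nat.eq_zero_or_pos q with rfl | hq
  · exact ⟨1, fun t => by simp⟩
  obtain ⟨C1, hC1⟩ := hmom q hq
  obtain ⟨C0, hC0⟩ := hA0.exists_le_add_tsum
  obtain ⟨K0, hK0⟩ := hA0.add_tsum_mul_pow_le (C0 + q) q
  set A : ℝ≥0 := ∑' j, α j with hA
  have hA1 : A < 1 := hA0.tsum_lt_one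
  set K : ℝ≥0 := max C1 (K0 / (1 - A)) with hK
  have hKstep : K0 + A * K ≤ K := by
    have h1 : K0 / (1 - A) ≤ K := le_max_right _ _
    rw [div_le_iff₀ (tsub_pos_of_lt hA1)] at h1
    calc K0 + A * K ≤ K * (1 - A) + A * K := add_le_add h1 le_rfl
      _ = K * ((1 - A) + A) := by ring
      _ = K := by rw [tsub_add_cancel_of_le hA1.le, mul_one]
  -- `K` is a fixed point bound: the recursion `u ↦ K0 + A u` maps `[0, K]` to itself.
  have hUmeas : ∀ t, Measurable fun ω => ((Y t ω - q : ℕ) : ℝ≥0∞) ^ q := fun t =>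
    (measurable_from_top (f := fun n : ℕ => ((n - q : ℕ) : ℝ≥0∞) ^ q)).comp (hY t)
  have hU : ∀ n : ℕ, ∀ t : ℤ, t ≤ k + n → ∫⁻ ω, ((Y t ω - q : ℕ) : ℝ≥0∞) ^ q ∂μ ≤ K := by
    intro n
    induction n with
    | zero =>
      intro t ht
      refine le_trans ?_ ((hC1 t (by simpa using ht)).trans
        (ENNReal.coe_le_coe.2 (le_max_left C1 (K0 / (1 - A)))))
      refine lintegral_mono fun ω => ?_
      gcongr
      exact Nat.sub_le _ _
    | succ n ih =>
      intro t ht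
      rcases le_or_gt t (k + n) with h | h
      · exact ih t h
      have hkt : k < t := by omega
      have hlam : Measurable[sigmaPast Y (t - 1)] fun ω => f θs (past Y t ω) :=
        hf.comp (measurable_past t)
      calc ∫⁻ ω, ((Y t ω - q : ℕ) : ℝ≥0∞) ^ q ∂μ
          ≤ ∫⁻ ω, ((Y t ω).descFactorial q : ℝ≥0∞) ∂μ := by
            refine lintegral_mono fun ω => ?_
            have h1 : (Y t ω - q) ^ q ≤ (Y t ω).descFactorial q :=
              (Nat.pow_le_pow_left (by omega) q).trans (Nat.pow_sub_le_descFactorial (Y t ω) q)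
            have h2 : (((Y t ω - q) ^ q : ℕ) : ℝ≥0∞) ≤ ((Y t ω).descFactorial q : ℝ≥0∞) :=
              Nat.cast_le.2 h1
            rwa [Nat.cast_pow] at h2
        _ = ∫⁻ ω, (f θs (past Y t ω) : ℝ≥0∞) ^ q ∂μ :=
            (hmodel t hkt).lintegral_descFactorial (sigmaPast_le hY _) (hY t) hlam q
        _ ≤ ∫⁻ ω, (K0 + ∑' j : ℕ, (α j : ℝ≥0∞) * ((Y (t - 1 - j) ω - q : ℕ) : ℝ≥0∞) ^ q) ∂μ := by
            refine lintegral_mono fun ω => ?_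
            have h2 := hK0 fun j => ((Y (t - 1 - j) ω - q : ℕ) : ℝ≥0)
            simp only [ENNReal.coe_natCast] at h2
            refine le_trans (pow_le_pow_left' ((hC0 θs hθs (past Y t ω)).trans ?_) q) h2
            calc (C0 : ℝ≥0∞) + ∑' j, (α j : ℝ≥0∞) * (past Y t ω j : ℝ≥0∞)
                ≤ C0 + ∑' j : ℕ, ((α j : ℝ≥0∞) * ((Y (t - 1 - j) ω - q : ℕ) : ℝ≥0∞)
                    + (α j : ℝ≥0∞) * q) := by
                  gcongr with j
                  rw [← mul_add]
                  gcongr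
                  simp only [past, ENNReal.coe_natCast]
                  exact_mod_cast (by omega : Y (t - 1 - j) ω ≤ Y (t - 1 - j) ω - q + q)
              _ = C0 + (∑' j : ℕ, (α j : ℝ≥0∞)) * q
                    + ∑' j : ℕ, (α j : ℝ≥0∞) * ((Y (t - 1 - j) ω - q : ℕ) : ℝ≥0∞) := by
                  rw [ENNReal.tsum_add, ENNReal.tsum_mul_right]; ring
              _ ≤ _ := by
                  push_cast
                  gcongr
                  exact mul_le_of_le_one_left zero_le hA0.sum_lt_one.le
        _ = K0 + ∑' j : ℕ, (α j : ℝ≥0∞) * ∫⁻ ω, ((Y (t - 1 - j) ω - q : ℕ) : ℝ≥0∞) ^ q ∂μ := by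
            rw [lintegral_add_left measurable_const, lintegral_const, measure_univ, mul_one,
              lintegral_tsum fun j => ((hUmeas _).const_mul _).aemeasurable]
            congr 1
            exact tsum_congr fun j => lintegral_const_mul _ (hUmeas _)
        _ ≤ K0 + ∑' j : ℕ, (α j : ℝ≥0∞) * K := by
            gcongr with j
            exact ih _ (by omega)
        _ = ((K0 + A * K : ℝ≥0) : ℝ≥0∞) := by
            rw [ENNReal.tsum_mul_right, ← ENNReal.coe_tsum hA0.summable]
            push_cast
            rfl
        _ ≤ K := ENNReal.coe_le_coe.2 hKstep
  refine ⟨2 ^ (q - 1) * (K + q ^ q), fun t => ?_⟩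
  calc ∫⁻ ω, (Y t ω : ℝ≥0∞) ^ q ∂μ
      ≤ ∫⁻ ω, 2 ^ (q - 1) * (((Y t ω - q : ℕ) : ℝ≥0∞) ^ q + (q : ℝ≥0∞) ^ q) ∂μ := by
        refine lintegral_mono fun ω => ?_
        have h1 : Y t ω ^ q ≤ 2 ^ (q - 1) * ((Y t ω - q) ^ q + q ^ q) :=
          (Nat.pow_le_pow_left (by omega) q).trans
            (add_pow_le (Nat.zero_le (Y t ω - q)) (Nat.zero_le q) q)
        have h2 : ((Y t ω ^ q : ℕ) : ℝ≥0∞)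
            ≤ ((2 ^ (q - 1) * ((Y t ω - q) ^ q + q ^ q) : ℕ) : ℝ≥0∞) := Nat.cast_le.2 h1
        simpa only [Nat.cast_pow, Nat.cast_mul, Nat.cast_add, Nat.cast_ofNat] using h2
    _ = 2 ^ (q - 1) * (∫⁻ ω, ((Y t ω - q : ℕ) : ℝ≥0∞) ^ q ∂μ + (q : ℝ≥0∞) ^ q) := by
        rw [lintegral_const_mul _ ((hUmeas t).add_const _), lintegral_add_left (hUmeas t),
          lintegral_const, measure_univ, mul_one]
    _ ≤ _ := by
        simp only [ENNReal.coe_mul, ENNReal.coe_pow, ENNReal.coe_ofNat, ENNReal.coe_add,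
          ENNReal.coe_natCast]
        gcongr
        exact hU (t - k).toNat t (by omega)

end CountProcess

end

/-! ### Laws of large numbers along the observations -/

section

section Compensated

variable {Ω : Type*} {m0 : MeasurableSpace Ω} {μ : Measure Ω}

lemma memLp_two_of_lintegral_sq_le [IsProbabilityMeasure μ] {h : Ω → ℝ} (hm : Measurable h)
    {C : ℝ≥0} (hC : ∫⁻ ω, ENNReal.ofReal (h ω ^ 2) ∂μ ≤ C) :
    MemLp h 2 μ ∧ ∫ ω, h ω ^ 2 ∂μ ≤ C := by
  constructor
  · rw [memLp_two_iff_integrable_sq hm.aestronglyMeasurable]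
    refine ⟨(hm.pow_const 2).aestronglyMeasurable, ?_⟩
    rw [hasFiniteIntegral_iff_ofReal (Eventually.of_forall fun ω => sq_nonneg _)]
    exact hC.trans_lt ENNReal.coe_lt_top
  · rw [integral_eq_lintegral_of_nonneg_ae (Eventually.of_forall fun ω => sq_nonneg _)
      (hm.pow_const 2).aestronglyMeasurable]
    exact ENNReal.toReal_le_of_le_ofReal C.coe_nonneg (by simpa using hC)

/-- Law of large numbers for a process minus its predictable compensator, with bounded predictable
multipliers. -/
theorem tendsto_average_compensated [IsProbabilityMeasure μ] {ℱ : Filtration ℕ m0}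
    {Z G u : ℕ → Ω → ℝ} {C : ℝ≥0} (hZ : ∀ i, Measurable[ℱ (i + 1)] (Z i))
    (hG : ∀ i, Measurable[ℱ i] (G i)) (hu : ∀ i, Measurable[ℱ i] (u i))
    (hZC : ∀ i, ∫⁻ ω, ENNReal.ofReal (Z i ω ^ 2) ∂μ ≤ C)
    (hGC : ∀ i, ∫⁻ ω, ENNReal.ofReal (G i ω ^ 2) ∂μ ≤ C)
    (hu1 : ∀ i ω, |u i ω| ≤ 1) (hcond : ∀ i, μ[Z i|ℱ i] =ᵐ[μ] G i) :
    ∀ᵐ ω ∂μ, Tendsto (fun n : ℕ => (∑ i ∈ range n, u i ω * (Z i ω - G i ω)) / (n : ℝ))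
      atTop (𝓝 0) := by
  have hZ0 : ∀ i, Measurable (Z i) := fun i => (hZ i).mono (ℱ.le _) le_rfl
  have hG0 : ∀ i, Measurable (G i) := fun i => (hG i).mono (ℱ.le _) le_rfl
  have hu0 : ∀ i, Measurable (u i) := fun i => (hu i).mono (ℱ.le _) le_rfl
  have hZL := fun i => memLp_two_of_lintegral_sq_le (hZ0 i) (hZC i)
  have hGL := fun i => memLp_two_of_lintegral_sq_le (hG0 i) (hGC i)
  have hD : ∀ i, MemLp (Z i - G i) 2 μ := fun i => (hZL i).1.sub (hGL i).1
  have hXL : ∀ i, MemLp (u i * (Z i - G i)) 2 μ := fun i =>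
    (hD i).of_le ((hu0 i).mul ((hZ0 i).sub (hG0 i))).aestronglyMeasurable
      (Eventually.of_forall fun ω => by
        simp only [Pi.mul_apply, norm_mul, Real.norm_eq_abs]
        exact mul_le_of_le_one_left (abs_nonneg _) (hu1 i ω))
  refine tendsto_average_of_martingaleDifference (ℱ := ℱ) (C := 4 * C)
    (X := fun i => u i * (Z i - G i)) (fun i => ?_) hXL (fun i => ?_) fun i => ?_
  · exact (((hu i).mono (ℱ.mono i.le_succ) le_rfl).mul
      ((hZ i).sub ((hG i).mono (ℱ.mono i.le_succ) le_rfl))).stronglyMeasurable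
  · have h1 : ∫ ω, (u i * (Z i - G i)) ω ^ 2 ∂μ ≤ ∫ ω, (2 * Z i ω ^ 2 + 2 * G i ω ^ 2) ∂μ := by
      refine integral_mono (hXL i).integrable_sq
        (((hZL i).1.integrable_sq.const_mul 2).add ((hGL i).1.integrable_sq.const_mul 2))
        fun ω => ?_
      have h2 : u i ω ^ 2 ≤ 1 := (sq_le_one_iff_abs_le_one _).2 (hu1 i ω)
      simp only [Pi.mul_apply, Pi.sub_apply]
      nlinarith [sq_nonneg (Z i ω + G i ω), sq_nonneg (Z i ω - G i ω)]
    rw [integral_add ((hZL i).1.integrable_sq.const_mul 2)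
      ((hGL i).1.integrable_sq.const_mul 2), integral_const_mul, integral_const_mul] at h1
    linarith [(hZL i).2, (hGL i).2]
  · have h1 := condExp_mul_of_stronglyMeasurable_left (m := ℱ i) (μ := μ)
      (hu i).stronglyMeasurable ((hXL i).integrable one_le_two) ((hD i).integrable one_le_two)
    have h2 := condExp_sub ((hZL i).1.integrable one_le_two)
      ((hGL i).1.integrable one_le_two) (ℱ i)
    have h3 := condExp_of_stronglyMeasurable (ℱ.le i) (hG i).stronglyMeasurable
      ((hGL i).1.integrable one_le_two)
    filter_upwards [h1, h2, hcond i] with ω h1 h2 h4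
    rw [h1, Pi.mul_apply, h2, Pi.sub_apply, h4, h3]
    simp

end Compensated

/-- The observed trajectory `Y_{k+1}, Y_{k+2}, …`, indexed from `0`. -/
def trajectory {Ω : Type*} (Y : ℤ → Ω → ℕ) (k : ℤ) (ω : Ω) : ℕ → ℕ := fun i => Y (k + 1 + i) ω

section CountProcess

variable {d : ℕ} {Ω : Type*} [mΩ : MeasurableSpace Ω] {μ : Measure Ω} {Y : ℤ → Ω → ℕ} {k : ℤ}
  {Θ : Set (EuclideanSpace ℝ (Fin d))} {f : MeanFamily d} {θs : EuclideanSpace ℝ (Fin d)}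
  {α : ℕ → ℝ≥0}

/-- The filtration `F_k, F_{k+1}, …`. -/
def filtrationFrom (hY : ∀ t, Measurable (Y t)) (k : ℤ) : Filtration ℕ mΩ where
  seq i := sigmaPast Y (k + i)
  mono' i j hij := sigmaPast_mono (by simpa using hij)
  le' i := sigmaPast_le hY _

lemma measurable_trajectory (hY : ∀ t, Measurable (Y t)) {i j : ℕ} (hij : i < j) :
    Measurable[filtrationFrom hY k j] fun ω => trajectory Y k ω i :=
  measurable_sigmaPast (by omega)

/-- Functionals of the first `i` observations are predictable at time `i`. -/
lemma measurable_of_dependsOn (hY : ∀ t, Measurable (Y t)) {i : ℕ} {φ : (ℕ → ℕ) → ℝ}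
    (hφ : DependsOn φ (Set.Iio i)) :
    Measurable[filtrationFrom hY k i] fun ω => φ (trajectory Y k ω) := by
  have h1 : (fun ω => φ (trajectory Y k ω)) = (fun x : Fin i → ℕ =>
      φ fun j => if h : j < i then x ⟨j, h⟩ else 0) ∘ fun ω (j : Fin i) => trajectory Y k ω j := by
    ext ω
    refine hφ fun j hj => ?_
    have : j < i := hj
    simp [this]
  rw [h1]
  refine (measurable_of_countable _).comp ?_
  exact (@measurable_pi_iff _ _ _ (filtrationFrom hY k i) _ _).2 fun j =>
    measurable_trajectory hY j.2

lemma measurable_condMean (hY : ∀ t, Measurable (Y t)) (hf : Measurable (f θs)) (i : ℕ) :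
    Measurable[filtrationFrom hY k i] fun ω => f θs (past Y (k + 1 + i) ω) := by
  have h := measurable_past (Y := Y) (k + 1 + i)
  rw [show k + 1 + (i : ℤ) - 1 = k + i by ring] at h
  exact hf.comp h

lemma IsPoissonARAfter.condPoisson (hY : ∀ t, Measurable (Y t))
    (hmodel : IsPoissonARAfter μ Y k f θs) (i : ℕ) :
    CondPoisson μ (filtrationFrom hY k i) (Y (k + 1 + i))
      fun ω => f θs (past Y (k + 1 + i) ω) := by
  have h := hmodel (k + 1 + i) (by omega)
  rwa [show k + 1 + (i : ℤ) - 1 = k + i by ring] at h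

variable [IsProbabilityMeasure μ]

/-- Averages of factorial powers of the observations follow those of powers of the conditional
means, along any bounded predictable weighting. -/
theorem tendsto_average_descFactorial (hY : ∀ t, Measurable (Y t))
    (hf : Measurable (f θs)) (hθs : θs ∈ Θ) (hmodel : IsPoissonARAfter μ Y k f θs)
    (hmom : BoundedPastMoments μ Y k) (hA0 : AssumptionA0 Θ f α) (q : ℕ)
    {φ : ℕ → (ℕ → ℕ) → ℝ} (hφ : ∀ i, DependsOn (φ i) (Set.Iio i)) (hφ1 : ∀ i y, |φ i y| ≤ 1) :
    ∀ᵐ ω ∂μ, Tendsto (fun n : ℕ => (∑ i ∈ range n, φ i (trajectory Y k ω)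
      * (((trajectory Y k ω i).descFactorial q : ℝ) - (f θs (past Y (k + 1 + i) ω) : ℝ) ^ q))
        / (n : ℝ)) atTop (𝓝 0) := by
  obtain ⟨C, hC⟩ := exists_moment_bound hY hf hθs hmodel hmom hA0 (q * 2)
  have hlam : ∀ i : ℕ, Measurable[filtrationFrom hY k i] fun ω => f θs (past Y (k + 1 + i) ω) :=
    measurable_condMean hY hf
  have hpois := hmodel.condPoisson hY
  have hdm : ∀ q : ℕ, Measurable fun n : ℕ => (n.descFactorial q : ℝ) := fun q =>
    measurable_from_top
  have hdle : ∀ (t : ℤ) (q : ℕ), ∫⁻ ω, ((Y t ω).descFactorial q : ℝ≥0∞) ∂μ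
      ≤ ∫⁻ ω, (Y t ω : ℝ≥0∞) ^ q ∂μ := fun t q => lintegral_mono fun ω => by
    have := Nat.cast_le (α := ℝ≥0∞) |>.2 (Nat.descFactorial_le_pow (Y t ω) q)
    rwa [Nat.cast_pow] at this
  have hZC : ∀ i : ℕ, ∫⁻ ω, ENNReal.ofReal (((Y (k + 1 + i) ω).descFactorial q : ℝ) ^ 2) ∂μ ≤ C := by
    intro i
    refine le_trans (lintegral_mono fun ω => ?_) (hC (k + 1 + i))
    have h1 : (Y (k + 1 + i) ω).descFactorial q ^ 2 ≤ Y (k + 1 + i) ω ^ (q * 2) := by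
      rw [pow_mul]
      exact Nat.pow_le_pow_left (Nat.descFactorial_le_pow _ q) 2
    have h2 := Nat.cast_le (α := ℝ≥0∞) |>.2 h1
    rw [← Nat.cast_pow, ENNReal.ofReal_natCast]
    simpa only [Nat.cast_pow] using h2
  refine tendsto_average_compensated (ℱ := filtrationFrom hY k) (C := C)
    (Z := fun i ω => ((trajectory Y k ω i).descFactorial q : ℝ))
    (G := fun i ω => (f θs (past Y (k + 1 + i) ω) : ℝ) ^ q)
    (u := fun i ω => φ i (trajectory Y k ω))
    (fun i => (hdm q).comp (measurable_trajectory hY i.lt_succ_self))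
    (fun i => (measurable_coe_nnreal_real.comp (hlam i)).pow_const q)
    (fun i => measurable_of_dependsOn hY (hφ i)) hZC (fun i => ?_) (fun i ω => hφ1 i _) fun i => ?_
  · refine le_trans (le_of_eq ?_) ((hdle (k + 1 + i) (q * 2)).trans (hC (k + 1 + i)))
    rw [(hpois i).lintegral_descFactorial (filtrationFrom hY k |>.le i) (hY _) (hlam i)]
    refine lintegral_congr fun ω => ?_
    rw [← pow_mul, ENNReal.ofReal_pow (NNReal.coe_nonneg _), ENNReal.ofReal_coe_nnreal]
  · refine (hpois i).condExp_descFactorial (filtrationFrom hY k |>.le i) (hY _) (hlam i) q ?_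
    exact (memLp_two_of_lintegral_sq_le ((hdm q).comp (hY _)) (hZC i)).1.integrable one_le_two

/-- Empirical frequencies of a value follow its conditional probabilities, along any bounded
predictable weighting. -/
theorem tendsto_average_indicator (hY : ∀ t, Measurable (Y t))
    (hf : Measurable (f θs)) (hmodel : IsPoissonARAfter μ Y k f θs) (v : ℕ)
    {φ : ℕ → (ℕ → ℕ) → ℝ} (hφ : ∀ i, DependsOn (φ i) (Set.Iio i)) (hφ1 : ∀ i y, |φ i y| ≤ 1) :
    ∀ᵐ ω ∂μ, Tendsto (fun n : ℕ => (∑ i ∈ range n, φ i (trajectory Y k ω)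
      * ((if trajectory Y k ω i = v then 1 else 0)
        - poissonWeight (f θs (past Y (k + 1 + i) ω)) v)) / (n : ℝ)) atTop (𝓝 0) := by
  have hlam : ∀ i : ℕ, Measurable[filtrationFrom hY k i] fun ω => f θs (past Y (k + 1 + i) ω) :=
    measurable_condMean hY hf
  have hone : ∀ h : Ω → ℝ, (∀ ω, 0 ≤ h ω) → (∀ ω, h ω ≤ 1) →
      ∫⁻ ω, ENNReal.ofReal (h ω ^ 2) ∂μ ≤ (1 : ℝ≥0) := by
    intro h h0 h1
    calc ∫⁻ ω, ENNReal.ofReal (h ω ^ 2) ∂μ ≤ ∫⁻ _, 1 ∂μ := lintegral_mono fun ω => by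
          rw [ENNReal.ofReal_le_one]
          exact pow_le_one₀ (h0 ω) (h1 ω)
      _ = (1 : ℝ≥0) := by simp
  refine tendsto_average_compensated (ℱ := filtrationFrom hY k) (C := 1)
    (Z := fun i ω => if trajectory Y k ω i = v then 1 else 0)
    (G := fun i ω => poissonWeight (f θs (past Y (k + 1 + i) ω)) v)
    (u := fun i ω => φ i (trajectory Y k ω))
    (fun i => (measurable_from_top (f := fun n : ℕ => if n = v then (1 : ℝ) else 0)).comp
      (measurable_trajectory hY i.lt_succ_self))
    (fun i => (measurable_poissonWeight v).comp (measurable_coe_nnreal_real.comp (hlam i)))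
    (fun i => measurable_of_dependsOn hY (hφ i)) (fun i => hone _ (fun ω => ?_) fun ω => ?_)
    (fun i => hone _ (fun ω => poissonWeight_nonneg (NNReal.coe_nonneg _) v)
      fun ω => poissonWeight_le_one (NNReal.coe_nonneg _) v) (fun i ω => hφ1 i _) fun i => ?_
  · split_ifs <;> norm_num
  · split_ifs <;> norm_num
  · have e : (fun ω => if trajectory Y k ω i = v then (1 : ℝ) else 0)
        = Set.indicator {ω | Y (k + 1 + i) ω = v} fun _ => 1 := by
      ext ω
      by_cases h : Y (k + 1 + i) ω = v <;> simp [Set.indicator, trajectory, h]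
    rw [e]
    exact hmodel.condPoisson hY i v

end CountProcess

end

/-! ### The unobserved past and identifiability -/

section

/-- The sequence `y` with all entries from `m` on replaced by `0`. -/
def cutoff (m : ℕ) (y : ℕ → ℝ≥0) : ℕ → ℝ≥0 := fun j => if j < m then y j else 0

/-- The observed past of the trajectory `y` at time `i`, most recent value first. -/
def observed (y : ℕ → ℕ) (i : ℕ) : ℕ → ℝ≥0 := fun j => if j < i then (y (i - 1 - j) : ℝ≥0) else 0

section CountProcess

variable {d : ℕ} {Ω : Type*} {Y : ℤ → Ω → ℕ} {k : ℤ}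
  {Θ : Set (EuclideanSpace ℝ (Fin d))} {f : MeanFamily d} {θs : EuclideanSpace ℝ (Fin d)}
  {α : ℕ → ℝ≥0}

lemma observedPast_eq_observed (ω : Ω) (i : ℕ) :
    observedPast Y k (k + 1 + i) ω = observed (trajectory Y k ω) i := by
  ext j
  simp only [observedPast, observed, trajectory]
  by_cases h : j < i
  · rw [if_pos h, if_pos (by omega)]
    congr 3
    omega
  · rw [if_neg h, if_neg (by omega)]

lemma observed_trajectory_eq_cutoff (ω : Ω) (i : ℕ) :
    observed (trajectory Y k ω) i = cutoff i (past Y (k + 1 + i) ω) := by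
  ext j
  simp only [cutoff, observed, trajectory, past]
  split_ifs with h
  · congr 3
    omega
  · rfl

/-- Forgetting the entries from `m` on changes the conditional mean by at most their weighted
sum. -/
lemma AssumptionA0.edist_cutoff_le (h : AssumptionA0 Θ f α) {θ : EuclideanSpace ℝ (Fin d)}
    (hθ : θ ∈ Θ) (m : ℕ) (y : ℕ → ℝ≥0) :
    edist (f θ y) (f θ (cutoff m y)) ≤ ∑' i, (α (i + m) : ℝ≥0∞) * (y (i + m) : ℝ≥0∞) := by
  refine (h.lipschitz θ hθ _ _).trans (le_of_eq ?_)
  rw [← ENNReal.summable.sum_add_tsum_nat_add' (k := m)]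
  rw [sum_eq_zero, zero_add]
  · refine tsum_congr fun i => ?_
    simp [cutoff, edist_zero_nnreal]
  · intro j hj
    simp [cutoff, mem_range.1 hj]

lemma AssumptionA0.tendsto_cutoff (h : AssumptionA0 Θ f α) {θ : EuclideanSpace ℝ (Fin d)}
    (hθ : θ ∈ Θ) {y : ℕ → ℝ≥0} (hy : ∑' j, (α j : ℝ≥0∞) * (y j : ℝ≥0∞) ≠ ∞) :
    Tendsto (fun m => f θ (cutoff m y)) atTop (𝓝 (f θ y)) := by
  rw [tendsto_iff_edist_tendsto_0]
  refine tendsto_of_tendsto_of_tendsto_of_le_of_le tendsto_const_nhds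
    (ENNReal.tendsto_sum_nat_add _ hy) (fun _ => zero_le) fun m => ?_
  rw [edist_comm]
  exact h.edist_cutoff_le hθ m y

variable [mΩ : MeasurableSpace Ω] {μ : Measure Ω}

lemma ae_tsum_mul_initial_ne_top [IsProbabilityMeasure μ] (hY : ∀ t, Measurable (Y t))
    (hmom : BoundedPastMoments μ Y k) {w : ℕ → ℝ≥0} (hw : Summable w) :
    ∀ᵐ ω ∂μ, ∑' i : ℕ, (w i : ℝ≥0∞) * (Y (k - i) ω : ℝ≥0∞) ≠ ∞ := by
  obtain ⟨C, hC⟩ := hmom 1 le_rfl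
  have hm : ∀ t, Measurable fun ω => (Y t ω : ℝ≥0∞) := fun t => measurable_from_top.comp (hY t)
  have h1 : ∫⁻ ω, ∑' i : ℕ, (w i : ℝ≥0∞) * (Y (k - i) ω : ℝ≥0∞) ∂μ ≠ ∞ := by
    rw [lintegral_tsum fun i => ((hm _).const_mul _).aemeasurable]
    refine ne_top_of_le_ne_top (b := (∑' i, (w i : ℝ≥0∞)) * C) ?_ ?_
    · exact ENNReal.mul_ne_top (ENNReal.tsum_coe_ne_top_iff_summable.2 hw) ENNReal.coe_ne_top
    · rw [← ENNReal.tsum_mul_right]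
      gcongr with i
      rw [lintegral_const_mul _ (hm _)]
      gcongr
      simpa using hC (k - i) (by omega)
  filter_upwards [ae_lt_top' (AEMeasurable.tsum fun i =>
    ((hm _).const_mul _).aemeasurable) h1] with ω hω
  exact hω.ne

/-- The unobserved past is forgotten: the conditional means and their approximations from the
observed values merge almost surely. -/
theorem tendsto_condMean_sub_observed [IsProbabilityMeasure μ] (hY : ∀ t, Measurable (Y t))
    (hθs : θs ∈ Θ) (hmom : BoundedPastMoments μ Y k) (hA0 : AssumptionA0 Θ f α)
    {γ : ℝ} (hγ : 1 < γ)
    (hα : (fun j : ℕ => (α j : ℝ)) =O[atTop] fun j : ℕ => ((j : ℝ) + 1) ^ (-γ)) :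
    ∀ᵐ ω ∂μ, Tendsto (fun i : ℕ => (f θs (past Y (k + 1 + i) ω) : ℝ)
      - f θs (observed (trajectory Y k ω) i)) atTop (𝓝 0) := by
  obtain ⟨B, hB0, hB⟩ : ∃ B : ℝ, 0 < B ∧ ∀ j : ℕ, (α j : ℝ) ≤ B * ((j : ℝ) + 1) ^ (-γ) := by
    obtain ⟨B, hB0, hB⟩ := Asymptotics.bound_of_isBigO_nat_atTop hα
    refine ⟨B, hB0, fun j => ?_⟩
    have hpos : (0 : ℝ) < ((j : ℝ) + 1) ^ (-γ) := by positivity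
    have := hB hpos.ne'
    rwa [Real.norm_of_nonneg (α j).coe_nonneg, Real.norm_of_nonneg hpos.le] at this
  have hwsum : Summable fun i : ℕ => ((i : ℝ) + 1) ^ (-γ) := by
    have := (summable_nat_add_iff 1).2 (Real.summable_nat_rpow.2 (by linarith : -γ < -1))
    simpa using this
  obtain ⟨w, hw⟩ : ∃ w : ℕ → ℝ≥0, ∀ i, (w i : ℝ) = ((i : ℝ) + 1) ^ (-γ) :=
    ⟨fun i => ⟨((i : ℝ) + 1) ^ (-γ), by positivity⟩, fun i => rfl⟩
  have hw' : Summable w := by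
    rw [← NNReal.summable_coe]
    simpa only [hw] using hwsum
  filter_upwards [ae_tsum_mul_initial_ne_top hY hmom hw'] with ω hω
  have hS : Summable fun i : ℕ => B * (((i : ℝ) + 1) ^ (-γ) * (Y (k - i) ω : ℝ)) := by
    refine Summable.mul_left B ?_
    have h1 : Summable fun i : ℕ => w i * (Y (k - i) ω : ℝ≥0) := by
      rw [← ENNReal.tsum_coe_ne_top_iff_summable]
      simpa using hω
    rw [← NNReal.summable_coe] at h1
    simpa [hw] using h1
  have hle : ∀ s i : ℕ, (α (i + s) : ℝ) * (Y (k - i) ω : ℝ)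
      ≤ B * (((i : ℝ) + 1) ^ (-γ) * (Y (k - i) ω : ℝ)) := by
    intro s i
    rw [← mul_assoc]
    refine mul_le_mul_of_nonneg_right ((hB _).trans ?_) (Nat.cast_nonneg _)
    refine mul_le_mul_of_nonneg_left ?_ hB0.le
    refine Real.rpow_le_rpow_of_nonpos (by positivity) ?_ (by linarith)
    push_cast
    linarith [(Nat.cast_nonneg s : (0 : ℝ) ≤ s)]
  have hnn : ∀ s i : ℕ, 0 ≤ (α (i + s) : ℝ) * (Y (k - i) ω : ℝ) := fun s i => by positivity
  have hsum : ∀ s : ℕ, Summable fun i : ℕ => (α (i + s) : ℝ) * (Y (k - i) ω : ℝ) := fun s =>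
    Summable.of_nonneg_of_le (hnn s) (hle s) hS
  have hα0 : Tendsto (fun j => (α j : ℝ)) atTop (𝓝 0) :=
    (NNReal.summable_coe.2 hA0.summable).tendsto_atTop_zero
  have hlim : Tendsto (fun s : ℕ => ∑' i : ℕ, (α (i + s) : ℝ) * (Y (k - i) ω : ℝ)) atTop (𝓝 0) := by
    have := tendsto_tsum_of_dominated_convergence (𝓕 := atTop) (g := fun _ : ℕ => (0 : ℝ))
      (f := fun s i : ℕ => (α (i + s) : ℝ) * (Y (k - i) ω : ℝ)) hS (fun i => ?_)
      (Eventually.of_forall fun s i => ?_)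
    · simpa using this
    · have h1 : Tendsto (fun s : ℕ => (α (i + s) : ℝ)) atTop (𝓝 0) :=
        hα0.comp (tendsto_add_atTop_nat i |>.congr fun s => add_comm s i)
      simpa using h1.mul_const (Y (k - i) ω : ℝ)
    · rw [Real.norm_of_nonneg (hnn s i)]
      exact hle s i
  refine squeeze_zero_norm (fun s => ?_) hlim
  rw [observed_trajectory_eq_cutoff, Real.norm_eq_abs, ← NNReal.dist_eq,
    ← edist_le_ofReal (tsum_nonneg (hnn s))]
  refine (hA0.edist_cutoff_le hθs s _).trans (le_of_eq ?_)
  rw [ENNReal.ofReal_tsum_of_nonneg (hnn s) (hsum s)]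
  refine tsum_congr fun i => ?_
  have e : k + 1 + (s : ℤ) - 1 - ((i + s : ℕ) : ℤ) = k - i := by push_cast; ring
  rw [ENNReal.ofReal_mul (NNReal.coe_nonneg _), ENNReal.ofReal_coe_nnreal, ENNReal.ofReal_natCast]
  simp only [past, e, ENNReal.coe_natCast]

/-- Identifiability is witnessed by a finite word: distinct parameters give distinct conditional
means for some past with finitely many non-zero values. The conditional means are almost surely
limits of their values at the cut-off pasts. -/
theorem exists_word_ne [IsProbabilityMeasure μ] (hY : ∀ t, Measurable (Y t))
    (hmom : BoundedPastMoments μ Y k) (hA0 : AssumptionA0 Θ f α) (hId : AssumptionId μ Y k Θ f)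
    {θ θ' : EuclideanSpace ℝ (Fin d)} (hθ : θ ∈ Θ) (hθ' : θ' ∈ Θ) (hne : θ ≠ θ') :
    ∃ (v : ℕ → ℕ) (m : ℕ),
      f θ (cutoff m fun j => (v j : ℝ≥0)) ≠ f θ' (cutoff m fun j => (v j : ℝ≥0)) := by
  by_contra! hall
  refine hne (hId θ hθ θ' hθ' ⟨k + 1, by omega, ?_⟩)
  filter_upwards [ae_tsum_mul_initial_ne_top hY hmom hA0.summable] with ω hω
  have hfin : ∑' j, (α j : ℝ≥0∞) * (past Y (k + 1) ω j : ℝ≥0∞) ≠ ∞ := by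
    simpa [past] using hω
  refine tendsto_nhds_unique (hA0.tendsto_cutoff hθ hfin) ?_
  refine (hA0.tendsto_cutoff hθ' hfin).congr fun m => ?_
  exact (hall (fun j => Y (k + 1 - 1 - j) ω) m).symm

end CountProcess

end

/-! ### Averages, causal convolutions and the Poisson divergence -/

section

lemma eventually_abs_sum_le {x : ℕ → ℝ}
    (h : Tendsto (fun n : ℕ => (∑ i ∈ range n, x i) / (n : ℝ)) atTop (𝓝 0)) {ε : ℝ} (hε : 0 < ε) :
    ∀ᶠ n : ℕ in atTop, |∑ i ∈ range n, x i| ≤ ε * n := by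
  have h1 := h.abs
  rw [abs_zero] at h1
  filter_upwards [h1.eventually (gt_mem_nhds hε), eventually_gt_atTop 0] with n h2 hn
  have hn' : (0 : ℝ) < n := by exact_mod_cast hn
  rw [abs_div, abs_of_pos hn', div_lt_iff₀ hn'] at h2
  exact h2.le

lemma exists_abs_sum_le {x : ℕ → ℝ}
    (h : Tendsto (fun n : ℕ => (∑ i ∈ range n, x i) / (n : ℝ)) atTop (𝓝 0)) :
    ∃ R : ℝ, 0 ≤ R ∧ ∀ n : ℕ, |∑ i ∈ range n, x i| ≤ R * n := by
  obtain ⟨R, hR⟩ := (Metric.isBounded_range_of_tendsto _ h).exists_norm_le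
  refine ⟨R, (norm_nonneg _).trans (hR _ ⟨0, rfl⟩), fun n => ?_⟩
  rcases Nat.eq_zero_or_pos n with rfl | hn
  · simp
  have hn' : (0 : ℝ) < n := by exact_mod_cast hn
  have h1 := hR _ ⟨n, rfl⟩
  simp only [Real.norm_eq_abs] at h1
  rwa [abs_div, abs_of_pos hn', div_le_iff₀ hn'] at h1

/-- A null sequence times a sequence with bounded averages has averages tending to zero. -/
lemma eventually_sum_abs_mul_le {e g : ℕ → ℝ} (he : Tendsto e atTop (𝓝 0)) (hg : ∀ i, 0 ≤ g i)
    {B : ℝ} (hB : ∀ n : ℕ, ∑ i ∈ range n, g i ≤ B * n) {ε : ℝ} (hε : 0 < ε) :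
    ∀ᶠ n : ℕ in atTop, ∑ i ∈ range n, |e i| * g i ≤ ε * n := by
  have hB0 : 0 ≤ B := by
    have := hB 1
    simp only [sum_range_one, Nat.cast_one, mul_one] at this
    exact (hg 0).trans this
  set η := ε / (2 * (B + 1)) with hη
  have hη0 : 0 < η := by positivity
  have h1 := he.abs
  rw [abs_zero] at h1
  obtain ⟨N, hN⟩ := eventually_atTop.1 (h1.eventually (gt_mem_nhds hη0))
  set S := ∑ i ∈ range N, |e i| * g i with hS
  have hS0 : 0 ≤ S := sum_nonneg fun i _ => mul_nonneg (abs_nonneg _) (hg i)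
  have hle : ∀ n : ℕ, ∑ i ∈ range n, |e i| * g i ≤ S + η * (B * n) := by
    intro n
    have h2 : ∑ i ∈ range n, |e i| * g i
        ≤ ∑ i ∈ range n, ((if i < N then |e i| * g i else 0) + η * g i) := by
      refine sum_le_sum fun i _ => ?_
      split_ifs with h
      · linarith [mul_nonneg hη0.le (hg i)]
      · rw [zero_add]
        exact mul_le_mul_of_nonneg_right (hN i (not_lt.1 h)).le (hg i)
    rw [sum_add_distrib, ← mul_sum] at h2
    have h3 : ∑ i ∈ range n, (if i < N then |e i| * g i else 0) ≤ S := by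
      rw [← sum_filter]
      refine sum_le_sum_of_subset_of_nonneg (fun i hi => ?_) fun i _ _ =>
        mul_nonneg (abs_nonneg _) (hg i)
      simp only [mem_filter] at hi
      exact mem_range.2 hi.2
    have h4 := mul_le_mul_of_nonneg_left (hB n) hη0.le
    linarith
  obtain ⟨N', hN'⟩ := exists_nat_gt (2 * S / ε)
  filter_upwards [eventually_ge_atTop N'] with n hn
  refine (hle n).trans ?_
  have h5 : S ≤ ε / 2 * n := by
    have : 2 * S / ε ≤ n := hN'.le.trans (by exact_mod_cast hn)
    rw [div_le_iff₀ hε] at this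
    linarith
  have h6 : η * B ≤ ε / 2 := by
    rw [hη, div_mul_eq_mul_div, div_le_div_iff₀ (by positivity) two_pos]
    nlinarith
  have h7 := mul_le_mul_of_nonneg_right h6 (Nat.cast_nonneg n : (0 : ℝ) ≤ n)
  linarith

/-- Summing a causal convolution over time. -/
lemma sum_convolution_le {β g : ℕ → ℝ} (hβ : ∀ j, 0 ≤ β j) (hg : ∀ i, 0 ≤ g i) (n : ℕ) :
    ∑ i ∈ range n, ∑ j ∈ range i, β j * g (i - 1 - j)
      ≤ (∑ j ∈ range n, β j) * ∑ i ∈ range n, g i := by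
  have h1 : ∑ i ∈ range n, ∑ j ∈ range i, β j * g (i - 1 - j)
      = ∑ j ∈ range n, ∑ i ∈ Ico (j + 1) n, β j * g (i - 1 - j) := by
    refine sum_comm' fun i j => ?_
    simp only [mem_range, mem_Ico]
    omega
  rw [h1, sum_mul]
  refine sum_le_sum fun j _ => ?_
  rw [← mul_sum]
  refine mul_le_mul_of_nonneg_left ?_ (hβ j)
  rw [sum_Ico_eq_sum_range]
  have h2 : ∀ r, j + 1 + r - 1 - j = r := fun r => by omega
  simp_rw [h2]
  exact sum_le_sum_of_subset_of_nonneg (range_mono (Nat.sub_le _ _)) fun i _ _ => hg i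

/-- A causal convolution tested against a sequence, split by the arithmetic-geometric mean
inequality with parameter `τ`. -/
lemma sum_mul_convolution_le {β r z : ℕ → ℝ} (hβ : ∀ j, 0 ≤ β j) {τ : ℝ} (hτ : 0 < τ) (n : ℕ) :
    ∑ i ∈ range n, r i * ∑ j ∈ range i, β j * z (i - 1 - j)
      ≤ (∑ j ∈ range n, β j)
        * (τ * ∑ i ∈ range n, r i ^ 2 + τ⁻¹ * ∑ i ∈ range n, z i ^ 2) := by
  have h1 : ∀ x y : ℝ, x * y ≤ τ * x ^ 2 + τ⁻¹ * y ^ 2 := by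
    intro x y
    have h2 : τ * x ^ 2 + τ⁻¹ * y ^ 2 - x * y
        = τ⁻¹ * ((τ * x - y / 2) ^ 2 + 3 / 4 * y ^ 2) := by
      field_simp
      ring
    have h3 : 0 ≤ τ⁻¹ * ((τ * x - y / 2) ^ 2 + 3 / 4 * y ^ 2) := by positivity
    linarith
  have h4 : ∑ i ∈ range n, r i * ∑ j ∈ range i, β j * z (i - 1 - j)
      ≤ ∑ i ∈ range n, ((∑ j ∈ range n, β j) * (τ * r i ^ 2)
        + ∑ j ∈ range i, β j * (τ⁻¹ * z (i - 1 - j) ^ 2)) := by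
    refine sum_le_sum fun i hi => ?_
    have h5 : r i * ∑ j ∈ range i, β j * z (i - 1 - j)
        ≤ ∑ j ∈ range i, (β j * (τ * r i ^ 2) + β j * (τ⁻¹ * z (i - 1 - j) ^ 2)) := by
      rw [mul_sum]
      refine sum_le_sum fun j _ => ?_
      have := mul_le_mul_of_nonneg_left (h1 (r i) (z (i - 1 - j))) (hβ j)
      linarith
    rw [sum_add_distrib, ← sum_mul] at h5
    refine h5.trans (add_le_add (mul_le_mul_of_nonneg_right ?_ (by positivity)) le_rfl)
    exact sum_le_sum_of_subset_of_nonneg (range_mono (mem_range.1 hi).le) fun j _ _ => hβ j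
  rw [sum_add_distrib] at h4
  have h6 := sum_convolution_le hβ (g := fun i => τ⁻¹ * z i ^ 2) (fun i => by positivity) n
  have h7 : ∑ i ∈ range n, (∑ j ∈ range n, β j) * (τ * r i ^ 2)
      = (∑ j ∈ range n, β j) * (τ * ∑ i ∈ range n, r i ^ 2) := by
    rw [← mul_sum, ← mul_sum]
  rw [← mul_sum] at h6
  rw [h7] at h4
  rw [mul_add]
  linarith

lemma abs_log_sub_log_le {c x y : ℝ} (hc : 0 < c) (hx : c ≤ x) (hy : c ≤ y) :
    |Real.log x - Real.log y| ≤ |x - y| / c := by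
  have key : ∀ x y : ℝ, c ≤ x → c ≤ y → Real.log x - Real.log y ≤ |x - y| / c := by
    intro x y hx hy
    have hx0 : 0 < x := hc.trans_le hx
    have hy0 : 0 < y := hc.trans_le hy
    rw [← Real.log_div hx0.ne' hy0.ne']
    refine (Real.log_le_sub_one_of_pos (div_pos hx0 hy0)).trans ?_
    rw [div_sub_one hy0.ne']
    refine (div_le_div_of_nonneg_right (le_abs_self _) hy0.le).trans ?_
    exact div_le_div_of_nonneg_left (abs_nonneg _) hc hy
  rw [abs_sub_le_iff]
  exact ⟨key x y hx hy, by rw [abs_sub_comm]; exact key y x hy hx⟩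

lemma abs_log_le {c x : ℝ} (hc : 0 < c) (hx : c ≤ x) : |Real.log x| ≤ |Real.log c| + x := by
  have h1 := Real.log_le_log hc hx
  have h2 := Real.log_le_sub_one_of_pos (hc.trans_le hx)
  have h3 := neg_abs_le (Real.log c)
  have h4 := abs_nonneg (Real.log c)
  rw [abs_le]
  constructor <;> linarith

/-- The Kullback–Leibler divergence `a log (a / b) - a + b` of the Poisson laws with means `a` and
`b` dominates the squared Hellinger-type distance `(√a - √b) ^ 2`, hence is bounded below in terms
of `|a - b|` on bounded sets. -/
lemma le_poisson_klDiv {a b δ M : ℝ} (ha : 0 < a) (hb : 0 < b) (haM : a ≤ M) (hbM : b ≤ M)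
    (hδ : 0 ≤ δ) (hab : δ ≤ |a - b|) :
    δ ^ 2 / (4 * M) ≤ a * (Real.log a - Real.log b) - a + b := by
  have hsa := Real.sqrt_pos.2 ha
  have hsb := Real.sqrt_pos.2 hb
  have ea := Real.sq_sqrt ha.le
  have eb := Real.sq_sqrt hb.le
  set s := Real.sqrt a
  set t := Real.sqrt b
  have h1 : Real.log b - Real.log a ≤ 2 * (t / s - 1) := by
    rw [← ea, ← eb, Real.log_pow, Real.log_pow]
    have := Real.log_le_sub_one_of_pos (div_pos hsb hsa)
    rw [Real.log_div hsb.ne' hsa.ne'] at this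
    push_cast
    linarith
  have h2 : a * (Real.log b - Real.log a) ≤ 2 * (s * t) - 2 * a := by
    have h3 := mul_le_mul_of_nonneg_left h1 ha.le
    have h4 : a * (2 * (t / s - 1)) = 2 * (s * t) - 2 * a := by
      rw [← ea]
      field_simp
    linarith
  have h5 : (s - t) ^ 2 ≤ a * (Real.log a - Real.log b) - a + b := by nlinarith
  refine le_trans ?_ h5
  have hM : 0 < M := ha.trans_le haM
  rw [div_le_iff₀ (by positivity)]
  have h6 : δ ^ 2 ≤ (a - b) ^ 2 := by
    rw [← sq_abs (a - b)]
    exact pow_le_pow_left₀ hδ hab 2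
  have h7 : (a - b) ^ 2 = (s - t) ^ 2 * (s + t) ^ 2 := by rw [← ea, ← eb]; ring
  have h8 : (s + t) ^ 2 ≤ 4 * M := by nlinarith [sq_nonneg (s - t)]
  calc δ ^ 2 ≤ (s - t) ^ 2 * (s + t) ^ 2 := h7 ▸ h6
    _ ≤ (s - t) ^ 2 * (4 * M) := mul_le_mul_of_nonneg_left h8 (sq_nonneg _)

lemma poisson_klDiv_nonneg {a b : ℝ} (ha : 0 < a) (hb : 0 < b) :
    0 ≤ a * (Real.log a - Real.log b) - a + b := by
  simpa using le_poisson_klDiv ha hb (le_max_left a b) (le_max_right a b) le_rfl (abs_nonneg _)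

lemma le_poissonWeight {c a M : ℝ} (hc : 0 < c) (hca : c ≤ a) (haM : a ≤ M) (v : ℕ) :
    Real.exp (-M) * c ^ v / (v.factorial : ℝ) ≤ poissonWeight a v := by
  unfold poissonWeight
  gcongr

end

/-! ### Typical paths -/

section

/-- Total influence, `l` steps later, of the observations made before time `s`. -/
noncomputable def influence (α : ℕ → ℝ≥0) (y : ℕ → ℕ) (s l : ℕ) : ℝ :=
  ∑ j ∈ range s, (α (l + j) : ℝ) * (y (s - 1 - j) : ℝ)

/-- The last `m` observations before time `i`, capped at the value `K`: a state with finitely many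
values. -/
def cappedState (m K : ℕ) (y : ℕ → ℕ) (i : ℕ) : Fin m → Fin (K + 1) := fun j =>
  ⟨min (if (j : ℕ) < i then y (i - 1 - j) else 0) K, by omega⟩

/-- The past with finitely many non-zero values that a capped state stands for. -/
def stateSeq {m K : ℕ} (x : Fin m → Fin (K + 1)) : ℕ → ℝ≥0 := fun j =>
  if h : j < m then ((x ⟨j, h⟩ : ℕ) : ℝ≥0) else 0

/-- At time `i` the last `l` observations are the initial segment `w 0, …, w (l - 1)` of the word
`w`, and when that segment started, the influence of the older observations was at most `M` over
the next `L` steps and at most `δ` after them. -/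
def PatternAt (α : ℕ → ℝ≥0) (L : ℕ) (M δ : ℝ) (w : ℕ → ℕ) (y : ℕ → ℕ) (l i : ℕ) : Prop :=
  l ≤ i ∧ (∀ r < L, influence α y (i - l) r ≤ M) ∧ influence α y (i - l) L ≤ δ ∧
    ∀ r < l, y (i - l + r) = w r

lemma influence_congr {α : ℕ → ℝ≥0} {y y' : ℕ → ℕ} {s : ℕ} (h : ∀ i < s, y i = y' i) (l : ℕ) :
    influence α y s l = influence α y' s l := by
  refine sum_congr rfl fun j hj => ?_
  have hj' := mem_range.1 hj
  rw [h (s - 1 - j) (by omega)]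

lemma cappedState_congr {m K i : ℕ} {y y' : ℕ → ℕ} (h : ∀ j < i, y j = y' j) :
    cappedState m K y i = cappedState m K y' i := by
  ext j
  simp only [cappedState]
  by_cases hj : (j : ℕ) < i
  · simp [hj, h (i - 1 - j) (by omega)]
  · simp [hj]

lemma PatternAt.congr {α : ℕ → ℝ≥0} {L : ℕ} {M δ : ℝ} {w y y' : ℕ → ℕ} {l i : ℕ}
    (h : ∀ j < i, y j = y' j) (hy : PatternAt α L M δ w y l i) : PatternAt α L M δ w y' l i := by
  obtain ⟨h1, h2, h3, h4⟩ := hy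
  have h5 : ∀ j < i - l, y j = y' j := fun j hj => h j (by omega)
  refine ⟨h1, fun r hr => ?_, ?_, fun r hr => ?_⟩
  · rw [← influence_congr h5]; exact h2 r hr
  · rw [← influence_congr h5]; exact h3
  · rw [← h _ (by omega)]; exact h4 r hr

lemma patternAt_congr {α : ℕ → ℝ≥0} {L : ℕ} {M δ : ℝ} {w y y' : ℕ → ℕ} {l i : ℕ}
    (h : ∀ j < i, y j = y' j) : PatternAt α L M δ w y l i ↔ PatternAt α L M δ w y' l i :=
  ⟨fun hy => hy.congr h, fun hy => hy.congr fun j hj => (h j hj).symm⟩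

lemma patternAt_succ_iff {α : ℕ → ℝ≥0} {L : ℕ} {M δ : ℝ} {w y : ℕ → ℕ} {l i : ℕ} :
    PatternAt α L M δ w y (l + 1) (i + 1) ↔ PatternAt α L M δ w y l i ∧ y i = w l := by
  have e : i + 1 - (l + 1) = i - l := by omega
  simp only [PatternAt, e, Nat.lt_succ_iff_lt_or_eq, Nat.add_le_add_iff_right]
  constructor
  · rintro ⟨h1, h2, h3, h4⟩
    refine ⟨⟨h1, h2, h3, fun r hr => h4 r (Or.inl hr)⟩, ?_⟩
    have := h4 l (Or.inr rfl)
    rwa [Nat.sub_add_cancel h1] at this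
  · rintro ⟨⟨h1, h2, h3, h4⟩, h5⟩
    refine ⟨h1, h2, h3, fun r hr => ?_⟩
    rcases hr with hr | rfl
    · exact h4 r hr
    · rwa [Nat.sub_add_cancel h1]

variable {d : ℕ}

open scoped Classical in
/-- The almost sure properties of the observed path `y` with conditional means `a` on which
consistency rests. The last two say that laws of large numbers hold along countably many predictable
events: the possible values of the capped states, and the occurrences of finite patterns. -/
structure TypicalPath (f : MeanFamily d) (α : ℕ → ℝ≥0) (θs : EuclideanSpace ℝ (Fin d))
    (y : ℕ → ℕ) (a : ℕ → ℝ) : Prop where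
  observed_approx : Tendsto (fun i => a i - f θs (observed y i)) atTop (𝓝 0)
  descFactorial : Tendsto
    (fun n : ℕ => (∑ i ∈ range n, (((y i).descFactorial 3 : ℝ) - a i ^ 3)) / (n : ℝ)) atTop (𝓝 0)
  capped : ∀ (m K : ℕ) (x : Fin m → Fin (K + 1)), Tendsto
    (fun n : ℕ => (∑ i ∈ range n, (if cappedState m K y i = x then 1 else 0) * ((y i : ℝ) - a i))
      / (n : ℝ)) atTop (𝓝 0)
  pattern : ∀ (L M j : ℕ) (w : List ℕ) (l : ℕ), Tendsto
    (fun n : ℕ => (∑ i ∈ range n,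
      (if PatternAt α L M (1 / ((j : ℝ) + 1)) (fun r => w.getD r 0) y l i then 1 else 0)
        * ((if y i = w.getD l 0 then 1 else 0) - poissonWeight (a i) (w.getD l 0)))
      / (n : ℝ)) atTop (𝓝 0)

section CountProcess

variable {Ω : Type*} [mΩ : MeasurableSpace Ω] {μ : Measure Ω} {Y : ℤ → Ω → ℕ} {k : ℤ}
  {Θ : Set (EuclideanSpace ℝ (Fin d))} {f : MeanFamily d} {θs : EuclideanSpace ℝ (Fin d)}
  {α : ℕ → ℝ≥0}

open scoped Classical in
/-- Almost every path is typical: only countably many laws of large numbers are involved. -/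
theorem ae_typicalPath [IsProbabilityMeasure μ] (hY : ∀ t, Measurable (Y t))
    (hf : Measurable (f θs)) (hθs : θs ∈ Θ) (hmodel : IsPoissonARAfter μ Y k f θs)
    (hmom : BoundedPastMoments μ Y k) (hA0 : AssumptionA0 Θ f α) {γ : ℝ} (hγ : 1 < γ)
    (hα : (fun j : ℕ => (α j : ℝ)) =O[atTop] fun j : ℕ => ((j : ℝ) + 1) ^ (-γ)) :
    ∀ᵐ ω ∂μ, TypicalPath f α θs (trajectory Y k ω) fun i => f θs (past Y (k + 1 + i) ω) := by
  have hone : ∀ (p : Prop) [Decidable p], |if p then (1 : ℝ) else 0| ≤ 1 := fun p _ => by split_ifs <;> simp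
  have h1 := tendsto_average_descFactorial hY hf hθs hmodel hmom hA0 3
    (φ := fun _ _ => 1) (fun i _ _ _ => rfl) fun i y => by simp
  have h2 : ∀ p : (m : ℕ) × (K : ℕ) × (Fin m → Fin (K + 1)), _ := fun p =>
    tendsto_average_descFactorial hY hf hθs hmodel hmom hA0 1
      (φ := fun i y => if cappedState p.1 p.2.1 y i = p.2.2 then 1 else 0)
      (fun i y y' h => by
        beta_reduce
        rw [cappedState_congr fun j hj => h j hj]) fun i y => hone _
  have h3 : ∀ p : ℕ × ℕ × ℕ × List ℕ × ℕ, _ := fun p =>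
    tendsto_average_indicator (μ := μ) (θs := θs) hY hf hmodel (p.2.2.2.1.getD p.2.2.2.2 0)
      (φ := fun i y => if PatternAt α p.1 p.2.1 (1 / ((p.2.2.1 : ℝ) + 1))
        (fun r => p.2.2.2.1.getD r 0) y p.2.2.2.2 i then 1 else 0)
      (fun i y y' h => by
        simp only [patternAt_congr fun j hj => h j hj]) fun i y => hone _
  filter_upwards [tendsto_condMean_sub_observed hY hθs hmom hA0 hγ hα, h1, ae_all_iff.2 h2,
    ae_all_iff.2 h3] with ω g0 g1 g2 g3
  refine ⟨g0, by simpa using g1, fun m K x => ?_, fun L M j w l => g3 ⟨L, M, j, w, l⟩⟩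
  simpa using g2 ⟨m, K, x⟩

end CountProcess

section Family

variable {Θ : Set (EuclideanSpace ℝ (Fin d))} {f : MeanFamily d} {α : ℕ → ℝ≥0}
  {θ : EuclideanSpace ℝ (Fin d)}

/-- The Lipschitz condition for sequences that agree from `N` on. -/
lemma AssumptionA0.abs_sub_le (h : AssumptionA0 Θ f α) (hθ : θ ∈ Θ) {x x' : ℕ → ℝ≥0} {N : ℕ}
    (hN : ∀ j, N ≤ j → x j = x' j) :
    |(f θ x : ℝ) - f θ x'| ≤ ∑ j ∈ range N, (α j : ℝ) * |(x j : ℝ) - x' j| := by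
  have h0 : ∀ j, 0 ≤ (α j : ℝ) * |(x j : ℝ) - x' j| := fun j =>
    mul_nonneg (α j).coe_nonneg (abs_nonneg _)
  rw [← NNReal.dist_eq, ← edist_le_ofReal (sum_nonneg fun j _ => h0 j)]
  refine (h.lipschitz θ hθ x x').trans (le_of_eq ?_)
  rw [tsum_eq_sum (s := range N), ENNReal.ofReal_sum_of_nonneg fun j _ => h0 j]
  · refine sum_congr rfl fun j _ => ?_
    rw [ENNReal.ofReal_mul (α j).coe_nonneg, ENNReal.ofReal_coe_nnreal, ← NNReal.dist_eq,
      edist_dist]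
  · intro j hj
    rw [hN j (by simpa using hj), edist_self, mul_zero]

lemma AssumptionA0.exists_le_add_sum (h : AssumptionA0 Θ f α) :
    ∃ C : ℝ, 0 ≤ C ∧ ∀ θ ∈ Θ, ∀ (x : ℕ → ℝ≥0) (N : ℕ), (∀ j, N ≤ j → x j = 0) →
      (f θ x : ℝ) ≤ C + ∑ j ∈ range N, (α j : ℝ) * x j := by
  obtain ⟨C, hC⟩ := h.bounded_zero
  refine ⟨C, C.coe_nonneg, fun θ hθ x N hN => ?_⟩
  have h1 := h.abs_sub_le hθ (x := x) (x' := 0) (N := N) hN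
  have h2 : (f θ 0 : ℝ) ≤ C := by exact_mod_cast hC θ hθ
  simp only [Pi.zero_apply, NNReal.coe_zero, sub_zero, abs_of_nonneg (NNReal.coe_nonneg _)] at h1
  linarith [le_abs_self ((f θ x : ℝ) - f θ 0)]

/-- The conditional mean computed from the observed past, bounded by a causal convolution. -/
lemma AssumptionA0.exists_observed_le (h : AssumptionA0 Θ f α) :
    ∃ C : ℝ, 0 ≤ C ∧ ∀ θ ∈ Θ, ∀ (y : ℕ → ℕ) (i : ℕ),
      (f θ (observed y i) : ℝ) ≤ C + ∑ j ∈ range i, (α j : ℝ) * (y (i - 1 - j) : ℝ) := by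
  obtain ⟨C, hC0, hC⟩ := h.exists_le_add_sum
  refine ⟨C, hC0, fun θ hθ y i => (hC θ hθ (observed y i) i fun j hj => ?_).trans (le_of_eq ?_)⟩
  · simp [observed, not_lt.2 hj]
  · congr 1
    refine sum_congr rfl fun j hj => ?_
    simp [observed, mem_range.1 hj]

lemma AssumptionA0.sum_le_one (h : AssumptionA0 Θ f α) (s : Finset ℕ) :
    ∑ j ∈ s, (α j : ℝ) ≤ 1 :=
  (h.sum_le_tsum s).trans (by exact_mod_cast h.tsum_lt_one.le)

lemma AssumptionA0.exists_tail_le (h : AssumptionA0 Θ f α) {η : ℝ} (hη : 0 < η) :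
    ∃ m₀ : ℕ, ∀ m ≥ m₀, ∀ n, ∑ j ∈ range n, (α (m + j) : ℝ) ≤ η := by
  have h1 := tendsto_sum_nat_add fun j => (α j : ℝ)
  obtain ⟨m₀, hm₀⟩ := eventually_atTop.1 (h1.eventually (gt_mem_nhds hη))
  refine ⟨m₀, fun m hm n => ?_⟩
  have h2 : Summable fun j => (α (j + m) : ℝ) :=
    (summable_nat_add_iff m).2 (NNReal.summable_coe.2 h.summable)
  refine le_trans ?_ (hm₀ m hm).le
  simp_rw [add_comm m]
  exact h2.sum_le_tsum _ fun j _ => NNReal.coe_nonneg _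

end Family

end

/-! ### Uniform law of large numbers for the likelihood -/

section

variable {d : ℕ} {Θ : Set (EuclideanSpace ℝ (Fin d))} {f : MeanFamily d} {α : ℕ → ℝ≥0}
  {θs : EuclideanSpace ℝ (Fin d)} {y : ℕ → ℕ} {a : ℕ → ℝ} {c : ℝ}

/-- Third moments have bounded averages along a typical path. As for the expectations, this follows
from Jensen's inequality, the total mass of the weights being below one. -/
lemma TypicalPath.exists_sum_cube_le (hT : TypicalPath f α θs y a) (hA0 : AssumptionA0 Θ f α)
    (hθs : θs ∈ Θ) (ha : ∀ i, 0 ≤ a i) :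
    ∃ B : ℝ, 0 ≤ B ∧ (∀ n : ℕ, ∑ i ∈ range n, (y i : ℝ) ^ 3 ≤ B * n) ∧
      ∀ n : ℕ, ∑ i ∈ range n, a i ^ 3 ≤ B * n := by
  obtain ⟨C, hC0, hC⟩ := hA0.exists_observed_le
  obtain ⟨E, hE⟩ := (Metric.isBounded_range_of_tendsto _ hT.observed_approx).exists_norm_le
  obtain ⟨R, hR0, hR⟩ := exists_abs_sum_le hT.descFactorial
  have hE0 : 0 ≤ E := (norm_nonneg _).trans (hE _ ⟨0, rfl⟩)
  set A : ℝ := ((∑' j, α j : ℝ≥0) : ℝ) with hA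
  have hA1 : A < 1 := by exact_mod_cast hA0.tsum_lt_one
  have hA0' : 0 ≤ A := NNReal.coe_nonneg _
  -- The shift by `3` turns the factorial moment into a bound on an ordinary power:
  -- `(y - 3) ^ 3 ≤ y (y - 1) (y - 2)`, with truncated subtraction.
  set U : ℕ → ℝ := fun i => ((y i - 3 : ℕ) : ℝ) with hU
  have hU0 : ∀ i, 0 ≤ U i := fun i => Nat.cast_nonneg _
  have hyU : ∀ i, (y i : ℝ) ≤ U i + 3 := fun i => by
    have : y i ≤ (y i - 3) + 3 := by omega
    simp only [hU]
    exact_mod_cast this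
  have ha1 : ∀ i, a i ≤ (C + E + 3) + ∑ j ∈ range i, (α j : ℝ) * U (i - 1 - j) := by
    intro i
    have h1 : a i - f θs (observed y i) ≤ E := (le_abs_self _).trans (hE _ ⟨i, rfl⟩)
    have h2 := hC θs hθs y i
    have h3 : ∑ j ∈ range i, (α j : ℝ) * (y (i - 1 - j) : ℝ)
        ≤ ∑ j ∈ range i, ((α j : ℝ) * U (i - 1 - j) + (α j : ℝ) * 3) := by
      refine sum_le_sum fun j _ => ?_
      rw [← mul_add]
      exact mul_le_mul_of_nonneg_left (hyU _) (α j).coe_nonneg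
    rw [sum_add_distrib, ← sum_mul] at h3
    have h4 := hA0.sum_le_one (range i)
    linarith
  set C0 : ℝ := ((C + E + 3) / (1 - A)) ^ 3 with hC0def
  have hC00 : 0 ≤ C0 := pow_nonneg (div_nonneg (by linarith) (by linarith)) 3
  have ha3 : ∀ i, a i ^ 3 ≤ C0 + ∑ j ∈ range i, (α j : ℝ) * U (i - 1 - j) ^ 3 := fun i =>
    (pow_le_pow_left₀ (ha i) (ha1 i) 3).trans
      (add_sum_mul_pow_le (range i) (w := fun j => (α j : ℝ)) (x := fun j => U (i - 1 - j))
        (fun j _ => (α j).coe_nonneg) (fun j _ => hU0 _) hA1 (hA0.sum_le_tsum _) (by linarith) 3)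
  have hsa : ∀ n : ℕ, ∑ i ∈ range n, a i ^ 3 ≤ C0 * n + A * ∑ i ∈ range n, U i ^ 3 := by
    intro n
    have h1 := sum_le_sum fun i (_ : i ∈ range n) => ha3 i
    rw [sum_add_distrib, sum_const, card_range, nsmul_eq_mul] at h1
    have h2 := sum_convolution_le (β := fun j => (α j : ℝ)) (g := fun i => U i ^ 3)
      (fun j => (α j).coe_nonneg) (fun i => pow_nonneg (hU0 i) 3) n
    have h3 := mul_le_mul_of_nonneg_right (hA0.sum_le_tsum (range n))
      (sum_nonneg fun i (_ : i ∈ range n) => pow_nonneg (hU0 i) 3)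
    linarith
  have hsU : ∀ n : ℕ, ∑ i ∈ range n, U i ^ 3 ≤ (C0 + R) / (1 - A) * n := by
    intro n
    have h1 : ∑ i ∈ range n, U i ^ 3 ≤ ∑ i ∈ range n, ((y i).descFactorial 3 : ℝ) := by
      refine sum_le_sum fun i _ => ?_
      have : (y i - 3) ^ 3 ≤ (y i).descFactorial 3 :=
        (Nat.pow_le_pow_left (by omega) 3).trans (Nat.pow_sub_le_descFactorial (y i) 3)
      simp only [hU]
      exact_mod_cast this
    have h2 := (le_abs_self _).trans (hR n)
    rw [sum_sub_distrib] at h2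
    have h3 := hsa n
    rw [div_mul_eq_mul_div, le_div_iff₀ (by linarith)]
    linarith
  set D := (C0 + R) / (1 - A) with hD
  have hD0 : 0 ≤ D := div_nonneg (by linarith) (by linarith)
  refine ⟨4 * (D + 27) + (C0 + A * D), by positivity, fun n => ?_, fun n => ?_⟩
  · have h1 : ∑ i ∈ range n, (y i : ℝ) ^ 3 ≤ ∑ i ∈ range n, (4 * U i ^ 3 + 4 * 27) := by
      refine sum_le_sum fun i _ => ?_
      have h2 := pow_le_pow_left₀ (Nat.cast_nonneg _) (hyU i) 3
      have h3 := add_pow_le (hU0 i) (by norm_num : (0 : ℝ) ≤ 3) 3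
      norm_num at h3
      linarith
    rw [sum_add_distrib, ← mul_sum, sum_const, card_range, nsmul_eq_mul] at h1
    have h4 := hsU n
    have h5 : 0 ≤ (C0 + A * D) * n := by positivity
    linarith
  · have h1 := hsa n
    have h2 := mul_le_mul_of_nonneg_left (hsU n) hA0'
    have h3 : 0 ≤ 4 * (D + 27) * n := by positivity
    linarith

lemma sum_pow_le_of_sum_cube_le {B : ℝ} (hB : ∀ n : ℕ, ∑ i ∈ range n, (y i : ℝ) ^ 3 ≤ B * n)
    {q : ℕ} (hq0 : q ≠ 0) (hq : q ≤ 3) (n : ℕ) : ∑ i ∈ range n, (y i : ℝ) ^ q ≤ B * n := by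
  refine le_trans (sum_le_sum fun i _ => ?_) (hB n)
  rcases Nat.eq_zero_or_pos (y i) with h | h
  · simp [h, hq0]
  · exact pow_le_pow_right₀ (by exact_mod_cast h) hq

/-- The effect of capping on the conditional mean: the excess over `K` of the values kept, and the
values older than `m` steps. -/
lemma AssumptionA0.abs_observed_sub_capped_le (hA0 : AssumptionA0 Θ f α)
    {θ : EuclideanSpace ℝ (Fin d)} (hθ : θ ∈ Θ) (y : ℕ → ℕ) (m K i : ℕ) :
    |(f θ (observed y i) : ℝ) - f θ (stateSeq (cappedState m K y i))|
      ≤ ∑ j ∈ range i, (α j : ℝ) * ((y (i - 1 - j) - K : ℕ) : ℝ)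
        + ∑ j ∈ range i, (if j < m then 0 else (α j : ℝ)) * (y (i - 1 - j) : ℝ) := by
  refine (hA0.abs_sub_le hθ (N := i) fun j hj => ?_).trans ?_
  · simp only [observed, stateSeq, cappedState, not_lt.2 hj, if_false]
    split_ifs <;> simp
  · rw [← sum_add_distrib]
    refine sum_le_sum fun j hj => ?_
    have hj' := mem_range.1 hj
    by_cases hm : j < m
    · simp only [observed, stateSeq, cappedState, hj', hm, if_true, dif_pos, zero_mul, add_zero]
      refine mul_le_mul_of_nonneg_left (le_of_eq ?_) (α j).coe_nonneg
      simp only [NNReal.coe_natCast]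
      rcases le_total (y (i - 1 - j)) K with h | h
      · simp [h]
      · rw [min_eq_right h, Nat.cast_sub h, abs_of_nonneg]
        exact sub_nonneg.2 (by exact_mod_cast h)
    · simp only [observed, stateSeq, hj', hm, if_true, if_false, dif_neg, not_false_eq_true]
      have h1 : (0 : ℝ) ≤ (α j : ℝ) * ((y (i - 1 - j) - K : ℕ) : ℝ) := by positivity
      simpa using h1

lemma AssumptionA0.exists_sum_tail_le (hA0 : AssumptionA0 Θ f α) {η : ℝ} (hη : 0 < η) :
    ∃ m : ℕ, ∀ n, ∑ j ∈ range n, (if j < m then 0 else (α j : ℝ)) ≤ η := by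
  obtain ⟨m, hm⟩ := hA0.exists_tail_le hη
  refine ⟨m, fun n => le_trans ?_ (hm m le_rfl n)⟩
  have h1 : ∑ j ∈ range (m + n), (if j < m then 0 else (α j : ℝ))
      = ∑ j ∈ range n, (α (m + j) : ℝ) := by
    rw [sum_range_add, sum_eq_zero fun j hj => by simp [mem_range.1 hj], zero_add]
    simp
  rw [← h1]
  refine sum_le_sum_of_subset_of_nonneg (range_mono (Nat.le_add_left n m)) fun j _ _ => ?_
  split_ifs
  · exact le_rfl
  · exact (α j).coe_nonneg

/-- Replacing observed pasts by capped states changes the martingale part of the likelihood by an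
arbitrarily small fraction of the sample size, uniformly in the parameter. -/
lemma TypicalPath.exists_capped_approx (hT : TypicalPath f α θs y a) (hA0 : AssumptionA0 Θ f α)
    (hθs : θs ∈ Θ) (ha : ∀ i, 0 ≤ a i) (hc : 0 < c) (hlow : ∀ θ ∈ Θ, ∀ x, c ≤ f θ x)
    {ε : ℝ} (hε : 0 < ε) :
    ∃ m K : ℕ, ∀ n : ℕ, ∀ θ ∈ Θ, ∑ i ∈ range n, |(y i : ℝ) - a i|
      * |Real.log (f θ (observed y i)) - Real.log (f θ (stateSeq (cappedState m K y i)))|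
        ≤ ε * n := by
  obtain ⟨B, hB0, hBy, hBa⟩ := hT.exists_sum_cube_le hA0 hθs ha
  set r : ℕ → ℝ := fun i => y i + a i with hr
  have hr0 : ∀ i, 0 ≤ r i := fun i => add_nonneg (Nat.cast_nonneg _) (ha i)
  set R : ℝ := 4 * B + 2 with hR
  have hrR : ∀ n : ℕ, ∑ i ∈ range n, r i ^ 2 ≤ R * n := by
    intro n
    have h1 : ∑ i ∈ range n, r i ^ 2
        ≤ ∑ i ∈ range n, (2 * (y i : ℝ) ^ 2 + (2 * a i ^ 3 + 2)) := by
      refine sum_le_sum fun i _ => ?_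
      have h2 : a i ^ 2 ≤ a i ^ 3 + 1 := by
        rcases le_total (a i) 1 with h | h
        · have := pow_le_one₀ (n := 2) (ha i) h
          linarith [pow_nonneg (ha i) 3]
        · linarith [pow_le_pow_right₀ h (by norm_num : 2 ≤ 3)]
      simp only [hr]
      nlinarith [sq_nonneg ((y i : ℝ) - a i)]
    rw [sum_add_distrib, sum_add_distrib, ← mul_sum, ← mul_sum, sum_const, card_range,
      nsmul_eq_mul] at h1
    have h3 := sum_pow_le_of_sum_cube_le hBy two_ne_zero (by norm_num) n
    have h4 := hBa n
    linarith
  have hR0 : 0 < R := by positivity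
  -- `τ`, `K`, `m` are chosen in this order: `τ` balances the arithmetic-geometric mean inequality
  -- against the averages of `r ^ 2`, then `K` makes the excesses over `K` small, using third moments,
  -- and `m` the total weight of the values that are dropped.
  set τ : ℝ := c * ε / (8 * R) with hτ
  have hτ0 : 0 < τ := by positivity
  have hτR : τ * R = c * ε / 8 := by rw [hτ]; field_simp
  obtain ⟨K, hK⟩ := exists_nat_gt (8 * (τ⁻¹ * B) / (c * ε))
  have hK0 : (0 : ℝ) < K := lt_of_le_of_lt (by positivity) hK
  have hKB : τ⁻¹ * (B / K) ≤ c * ε / 8 := by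
    rw [div_lt_iff₀ (by positivity)] at hK
    rw [← mul_div_assoc, div_le_iff₀ hK0]
    linarith
  set η : ℝ := c * ε / (4 * (R + B)) with hη
  have hη0 : 0 < η := by positivity
  have hηR : η * (R + B) = c * ε / 4 := by rw [hη]; field_simp
  obtain ⟨m, hm⟩ := hA0.exists_sum_tail_le hη0
  refine ⟨m, K, fun n θ hθ => ?_⟩
  set V : ℕ → ℝ := fun i => ((y i - K : ℕ) : ℝ) with hV
  have hVB : ∑ i ∈ range n, V i ^ 2 ≤ B / K * n := by
    have h1 : ∑ i ∈ range n, V i ^ 2 ≤ ∑ i ∈ range n, (y i : ℝ) ^ 3 / K := by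
      refine sum_le_sum fun i _ => ?_
      rw [le_div_iff₀ hK0]
      have h2 : (y i - K) ^ 2 * K ≤ y i ^ 3 := by
        rcases le_total (y i) K with h | h
        · simp [Nat.sub_eq_zero_of_le h]
        · rw [pow_succ (y i) 2]
          exact Nat.mul_le_mul (Nat.pow_le_pow_left (Nat.sub_le _ _) 2) h
      simp only [hV]
      exact_mod_cast h2
    rw [← sum_div] at h1
    refine h1.trans ?_
    rw [div_mul_eq_mul_div]
    exact div_le_div_of_nonneg_right (hBy n) hK0.le
  have hterm : ∀ i, |(y i : ℝ) - a i|
      * |Real.log (f θ (observed y i)) - Real.log (f θ (stateSeq (cappedState m K y i)))|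
      ≤ (r i * ∑ j ∈ range i, (α j : ℝ) * V (i - 1 - j)
        + r i * ∑ j ∈ range i, (if j < m then 0 else (α j : ℝ)) * (y (i - 1 - j) : ℝ)) / c := by
    intro i
    have h1 : |(y i : ℝ) - a i| ≤ r i := by
      rw [abs_le]
      have := ha i
      have : (0 : ℝ) ≤ y i := Nat.cast_nonneg _
      constructor <;> simp only [hr] <;> linarith
    have h2 := (abs_log_sub_log_le hc (hlow θ hθ (observed y i))
      (hlow θ hθ (stateSeq (cappedState m K y i)))).trans
      (div_le_div_of_nonneg_right (hA0.abs_observed_sub_capped_le hθ y m K i) hc.le)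
    refine (mul_le_mul h1 h2 (abs_nonneg _) (hr0 i)).trans (le_of_eq ?_)
    rw [← mul_add, mul_div_assoc]
  refine (sum_le_sum fun i _ => hterm i).trans ?_
  rw [← sum_div, sum_add_distrib, div_le_iff₀ hc]
  have g1 := sum_mul_convolution_le (β := fun j => (α j : ℝ)) (r := r) (z := V)
    (fun j => (α j).coe_nonneg) hτ0 n
  have g2 := sum_mul_convolution_le (β := fun j => if j < m then 0 else (α j : ℝ)) (r := r)
    (z := fun i => (y i : ℝ)) (fun j => by split_ifs; exacts [le_rfl, (α j).coe_nonneg])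
    one_pos n
  have hn0 : (0 : ℝ) ≤ n := Nat.cast_nonneg n
  have k1 : (∑ j ∈ range n, (α j : ℝ))
      * (τ * ∑ i ∈ range n, r i ^ 2 + τ⁻¹ * ∑ i ∈ range n, V i ^ 2) ≤ c * ε / 4 * n := by
    have h1 := mul_le_mul_of_nonneg_left (hrR n) hτ0.le
    have h2 := mul_le_mul_of_nonneg_left hVB (inv_pos.2 hτ0).le
    have h3 := mul_le_mul_of_nonneg_right hKB hn0
    have h4 : τ * (R * n) = c * ε / 8 * n := by rw [← mul_assoc, hτR]
    have h5 : 0 ≤ τ * ∑ i ∈ range n, r i ^ 2 + τ⁻¹ * ∑ i ∈ range n, V i ^ 2 := by positivity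
    have h6 := mul_le_mul_of_nonneg_right (hA0.sum_le_one (range n)) h5
    linarith
  have k2 : (∑ j ∈ range n, (if j < m then 0 else (α j : ℝ)))
      * (1 * ∑ i ∈ range n, r i ^ 2 + 1⁻¹ * ∑ i ∈ range n, (y i : ℝ) ^ 2) ≤ c * ε / 4 * n := by
    have h1 := hrR n
    have h2 := sum_pow_le_of_sum_cube_le hBy two_ne_zero (by norm_num) n
    have h3 : 1 * ∑ i ∈ range n, r i ^ 2 + 1⁻¹ * ∑ i ∈ range n, (y i : ℝ) ^ 2
        ≤ (R + B) * n := by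
      rw [inv_one]
      linarith
    have h4 : 0 ≤ 1 * ∑ i ∈ range n, r i ^ 2 + 1⁻¹ * ∑ i ∈ range n, (y i : ℝ) ^ 2 := by
      positivity
    refine (mul_le_mul (hm n) h3 h4 hη0.le).trans (le_of_eq ?_)
    rw [← mul_assoc, hηR]
  have hfin : 0 ≤ c * ε / 2 * n := by positivity
  linarith

/-- Uniform law of large numbers for the martingale part of the likelihood. Capped states take
finitely many values, so uniformity in the parameter costs nothing for them. -/
lemma TypicalPath.eventually_abs_sum_mul_log_le (hT : TypicalPath f α θs y a)
    (hA0 : AssumptionA0 Θ f α) (hθs : θs ∈ Θ) (ha : ∀ i, 0 ≤ a i) (hc : 0 < c)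
    (hlow : ∀ θ ∈ Θ, ∀ x, c ≤ f θ x) {ε : ℝ} (hε : 0 < ε) :
    ∀ᶠ n : ℕ in atTop, ∀ θ ∈ Θ,
      |∑ i ∈ range n, ((y i : ℝ) - a i) * Real.log (f θ (observed y i))| ≤ ε * n := by
  obtain ⟨m, K, hmK⟩ := hT.exists_capped_approx hA0 hθs ha hc hlow (half_pos hε)
  obtain ⟨C, hC0, hC⟩ := hA0.exists_le_add_sum
  set H : ℝ := |Real.log c| + (C + K) with hH
  have hH0 : 0 ≤ H := by positivity
  have hlog : ∀ θ ∈ Θ, ∀ x : Fin m → Fin (K + 1), |Real.log (f θ (stateSeq x))| ≤ H := by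
    intro θ hθ x
    refine (abs_log_le hc (hlow θ hθ _)).trans (add_le_add le_rfl ?_)
    refine (hC θ hθ (stateSeq x) m fun j hj => ?_).trans (add_le_add le_rfl ?_)
    · simp [stateSeq, not_lt.2 hj]
    · have h1 : ∑ j ∈ range m, (α j : ℝ) * (stateSeq x j : ℝ) ≤ ∑ j ∈ range m, (α j : ℝ) * K := by
        refine sum_le_sum fun j hj => mul_le_mul_of_nonneg_left ?_ (α j).coe_nonneg
        simp only [stateSeq, mem_range.1 hj, dif_pos, NNReal.coe_natCast]
        exact_mod_cast Nat.lt_succ_iff.1 (x ⟨j, mem_range.1 hj⟩).2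
      rw [← sum_mul] at h1
      have h2 := mul_le_mul_of_nonneg_right (hA0.sum_le_one (range m))
        (Nat.cast_nonneg K : (0 : ℝ) ≤ K)
      linarith
  set Q : ℝ := (Fintype.card (Fin m → Fin (K + 1)) : ℝ) with hQ
  have hQ0 : 0 ≤ Q := Nat.cast_nonneg _
  set ε' : ℝ := ε / (2 * ((H + 1) * (Q + 1))) with hε'
  have hε'0 : 0 < ε' := by positivity
  have hε'le : Q * (H * ε') ≤ ε / 2 := by
    have h1 : Q * (H * ε') = ε / 2 * (Q * H / ((H + 1) * (Q + 1))) := by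
      rw [hε']
      field_simp
    rw [h1]
    refine mul_le_of_le_one_right (by positivity) ?_
    rw [div_le_one (by positivity)]
    nlinarith
  have hcap : ∀ᶠ n : ℕ in atTop, ∀ x : Fin m → Fin (K + 1),
      |∑ i ∈ range n, (if cappedState m K y i = x then 1 else 0) * ((y i : ℝ) - a i)| ≤ ε' * n :=
    eventually_all.2 fun x => eventually_abs_sum_le (hT.capped m K x) hε'0
  filter_upwards [hcap] with n hn θ hθ
  have e1 : ∑ i ∈ range n, ((y i : ℝ) - a i) * Real.log (f θ (stateSeq (cappedState m K y i)))
      = ∑ x : Fin m → Fin (K + 1), Real.log (f θ (stateSeq x))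
        * ∑ i ∈ range n, (if cappedState m K y i = x then 1 else 0) * ((y i : ℝ) - a i) := by
    simp_rw [mul_sum]
    rw [sum_comm]
    refine sum_congr rfl fun i _ => ?_
    rw [sum_eq_single (cappedState m K y i)]
    · simp [mul_comm]
    · intro x _ hx
      simp [hx.symm]
    · simp
  have e2 : |∑ i ∈ range n, ((y i : ℝ) - a i)
      * Real.log (f θ (stateSeq (cappedState m K y i)))| ≤ ε / 2 * n := by
    rw [e1]
    refine (abs_sum_le_sum_abs _ _).trans ?_
    calc _ ≤ ∑ _x : Fin m → Fin (K + 1), H * (ε' * n) := by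
          refine sum_le_sum fun x _ => ?_
          rw [abs_mul]
          exact mul_le_mul (hlog θ hθ x) (hn x) (abs_nonneg _) hH0
      _ = Q * (H * ε') * n := by
          rw [sum_const, card_univ, nsmul_eq_mul]
          ring
      _ ≤ ε / 2 * n := mul_le_mul_of_nonneg_right hε'le (Nat.cast_nonneg n)
  have e3 : |∑ i ∈ range n, ((y i : ℝ) - a i) * (Real.log (f θ (observed y i))
      - Real.log (f θ (stateSeq (cappedState m K y i))))| ≤ ε / 2 * n := by
    refine (abs_sum_le_sum_abs _ _).trans (le_trans (le_of_eq ?_) (hmK n θ hθ))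
    exact sum_congr rfl fun i _ => abs_mul _ _
  have e4 : ∑ i ∈ range n, ((y i : ℝ) - a i) * Real.log (f θ (observed y i))
      = ∑ i ∈ range n, ((y i : ℝ) - a i) * Real.log (f θ (stateSeq (cappedState m K y i)))
        + ∑ i ∈ range n, ((y i : ℝ) - a i) * (Real.log (f θ (observed y i))
          - Real.log (f θ (stateSeq (cappedState m K y i)))) := by
    rw [← sum_add_distrib]
    exact sum_congr rfl fun i _ => by ring
  rw [e4]
  refine (abs_add_le _ _).trans ?_
  linarith

end

/-! ### Frequency of patterns and growth of the divergence -/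

section

variable {d : ℕ} {Θ : Set (EuclideanSpace ℝ (Fin d))} {f : MeanFamily d} {α : ℕ → ℝ≥0}
  {θs : EuclideanSpace ℝ (Fin d)} {y : ℕ → ℕ} {a : ℕ → ℝ} {c : ℝ}

lemma AssumptionA0.sum_shift_le_one (hA0 : AssumptionA0 Θ f α) (l n : ℕ) :
    ∑ j ∈ range n, (α (l + j) : ℝ) ≤ 1 := by
  have h1 := hA0.sum_le_one (range (l + n))
  rw [sum_range_add] at h1
  have h2 : 0 ≤ ∑ j ∈ range l, (α j : ℝ) := sum_nonneg fun j _ => (α j).coe_nonneg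
  linarith

lemma influence_nonneg (s l : ℕ) : 0 ≤ influence α y s l :=
  sum_nonneg fun _ _ => by positivity

/-- While a pattern builds up, the observed past stays bounded. -/
lemma PatternAt.sum_le (hA0 : AssumptionA0 Θ f α) {L l i : ℕ} {M δ : ℝ} {w : ℕ → ℕ} (hl : l < L)
    (h : PatternAt α L M δ w y l i) :
    ∑ j ∈ range i, (α j : ℝ) * (y (i - 1 - j) : ℝ) ≤ ∑ r ∈ range L, (w r : ℝ) + M := by
  obtain ⟨h1, h2, -, h4⟩ := h
  obtain ⟨s, rfl⟩ := Nat.exists_eq_add_of_le h1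
  rw [Nat.add_sub_cancel_left] at h2 h4
  rw [sum_range_add]
  refine add_le_add ?_ (le_trans (le_of_eq ?_) (h2 l hl))
  · set W := ∑ r ∈ range L, (w r : ℝ) with hW
    have hW0 : 0 ≤ W := sum_nonneg fun r _ => Nat.cast_nonneg _
    have h5 : ∑ j ∈ range l, (α j : ℝ) * (y (l + s - 1 - j) : ℝ) ≤ ∑ j ∈ range l, (α j : ℝ) * W := by
      refine sum_le_sum fun j hj => mul_le_mul_of_nonneg_left ?_ (α j).coe_nonneg
      have hj' := mem_range.1 hj
      rw [show l + s - 1 - j = s + (l - 1 - j) by omega, h4 _ (by omega)]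
      exact single_le_sum (f := fun r => (w r : ℝ)) (fun r _ => Nat.cast_nonneg _)
        (mem_range.2 (by omega))
    rw [← sum_mul] at h5
    exact h5.trans (mul_le_of_le_one_left hW0 (hA0.sum_le_one _))
  · refine sum_congr rfl fun j _ => ?_
    rw [show l + s - 1 - (l + j) = s - 1 - j by omega]

/-- When a complete pattern spells out a finite word, most recent value first, the conditional mean
is close to its value at that word. -/
lemma PatternAt.abs_sub_le (hA0 : AssumptionA0 Θ f α) {θ : EuclideanSpace ℝ (Fin d)} (hθ : θ ∈ Θ)
    {L m i : ℕ} {M δ : ℝ} {v w : ℕ → ℕ} (hm : m ≤ L)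
    (hw : ∀ r < L, w r = if L - 1 - r < m then v (L - 1 - r) else 0)
    (h : PatternAt α L M δ w y L i) :
    |(f θ (observed y i) : ℝ) - f θ (cutoff m fun j => (v j : ℝ≥0))| ≤ δ := by
  obtain ⟨h1, -, h3, h4⟩ := h
  obtain ⟨s, rfl⟩ := Nat.exists_eq_add_of_le h1
  rw [Nat.add_sub_cancel_left] at h3 h4
  refine (hA0.abs_sub_le hθ (N := L + s) fun j hj => ?_).trans ?_
  · simp [observed, cutoff, show ¬ j < L + s by omega, show ¬ j < m by omega]
  rw [sum_range_add, sum_eq_zero, zero_add]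
  · refine le_trans (le_of_eq (sum_congr rfl fun j hj => ?_)) h3
    have hj' := mem_range.1 hj
    simp [observed, cutoff, show ¬ L + j < m by omega, hj',
      show L + s - 1 - (L + j) = s - 1 - j by omega]
  · intro j hj
    have hj' := mem_range.1 hj
    simp only [observed, cutoff, show j < L + s by omega, if_true,
      show L + s - 1 - j = s + (L - 1 - j) by omega]
    rw [h4 _ (by omega), hw _ (by omega), show L - 1 - (L - 1 - j) = j by omega]
    split_ifs <;> simp

open scoped Classical in
/-- Along a path with bounded averages, for suitable `L` and `M` at least half of the times are
admissible starting points of a pattern: by Markov's inequality the influence of the older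
observations is rarely large. -/
lemma exists_sum_patternAt_zero_ge (hA0 : AssumptionA0 Θ f α) {B : ℝ} (hB0 : 0 ≤ B)
    (hB : ∀ n : ℕ, ∑ i ∈ range n, (y i : ℝ) ≤ B * n) {δ : ℝ} (hδ : 0 < δ) (m : ℕ) :
    ∃ L M : ℕ, m ≤ L ∧ ∀ (w : ℕ → ℕ) (n : ℕ), (n : ℝ) / 2
      ≤ ∑ i ∈ range n, (if PatternAt α L M δ w y 0 i then (1 : ℝ) else 0) := by
  obtain ⟨m₀, hm₀⟩ := hA0.exists_tail_le (η := δ / (4 * (B + 1))) (by positivity)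
  set L := max m m₀ with hL
  obtain ⟨M, hM⟩ := exists_nat_gt (4 * (L * B))
  have hM0 : (0 : ℝ) < M := lt_of_le_of_lt (by positivity) hM
  refine ⟨L, M, le_max_left _ _, fun w n => ?_⟩
  have hn0 : (0 : ℝ) ≤ n := Nat.cast_nonneg n
  have hsum : ∀ l : ℕ, ∑ i ∈ range n, influence α y i l
      ≤ (∑ j ∈ range n, (α (l + j) : ℝ)) * (B * n) := by
    intro l
    refine (sum_convolution_le (β := fun j => (α (l + j) : ℝ)) (g := fun i => (y i : ℝ))
      (fun j => NNReal.coe_nonneg _) (fun i => Nat.cast_nonneg _) n).trans ?_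
    exact mul_le_mul_of_nonneg_left (hB n) (sum_nonneg fun j _ => NNReal.coe_nonneg _)
  have hterm : ∀ i, (1 : ℝ) ≤ (if PatternAt α L M δ w y 0 i then (1 : ℝ) else 0)
      + (∑ l ∈ range L, influence α y i l / M + influence α y i L / δ) := by
    intro i
    have h0 : ∀ l ∈ range L, 0 ≤ influence α y i l / M := fun l _ =>
      div_nonneg (influence_nonneg i l) hM0.le
    have h0' : 0 ≤ influence α y i L / δ := div_nonneg (influence_nonneg i L) hδ.le
    split_ifs with h
    · linarith [sum_nonneg h0]
    · rw [zero_add]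
      by_cases h1 : influence α y i L ≤ δ
      · have h2 : ∃ l < L, (M : ℝ) < influence α y i l := by
          by_contra! h2
          exact h ⟨Nat.zero_le _, fun r hr => h2 r hr, h1, fun r hr => absurd hr (Nat.not_lt_zero r)⟩
        obtain ⟨l, hl, hMl⟩ := h2
        have h3 := single_le_sum h0 (mem_range.2 hl)
        have h4 : 1 ≤ influence α y i l / M := (one_le_div hM0).2 hMl.le
        linarith
      · have h4 : 1 ≤ influence α y i L / δ := (one_le_div hδ).2 (not_le.1 h1).le
        linarith [sum_nonneg h0]
  have h1 := sum_le_sum fun i (_ : i ∈ range n) => hterm i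
  rw [sum_const, card_range, nsmul_eq_mul, mul_one, sum_add_distrib, sum_add_distrib, sum_comm,
    ← sum_div] at h1
  have h2 : ∑ l ∈ range L, ∑ i ∈ range n, influence α y i l / M ≤ (n : ℝ) / 4 := by
    calc _ ≤ ∑ _l ∈ range L, B * n / M := by
          refine sum_le_sum fun l _ => ?_
          rw [← sum_div]
          refine div_le_div_of_nonneg_right ((hsum l).trans ?_) hM0.le
          exact mul_le_of_le_one_left (by positivity) (hA0.sum_shift_le_one l n)
      _ = L * B * n / M := by
          rw [sum_const, card_range, nsmul_eq_mul]
          ring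
      _ ≤ n / 4 := by
          rw [div_le_iff₀ hM0]
          have := mul_le_mul_of_nonneg_right hM.le hn0
          linarith
  have h3 : (∑ i ∈ range n, influence α y i L) / δ ≤ (n : ℝ) / 4 := by
    rw [div_le_iff₀ hδ]
    refine (hsum L).trans ?_
    have h4 := mul_le_mul_of_nonneg_right (hm₀ L (le_max_right _ _) n)
      (by positivity : 0 ≤ B * n)
    refine h4.trans ?_
    rw [div_mul_eq_mul_div, div_le_iff₀ (by positivity)]
    have : 0 ≤ δ * n := by positivity
    nlinarith
  linarith

open scoped Classical in
/-- If a pattern shows up with positive frequency up to length `l`, so it does up to length `l + 1`: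
while it builds up, the conditional mean is bounded, so the next symbol has a conditional
probability bounded below. -/
lemma TypicalPath.pattern_frequency_succ (hT : TypicalPath f α θs y a) (hA0 : AssumptionA0 Θ f α)
    (hθs : θs ∈ Θ) (hc : 0 < c) (hac : ∀ i, c ≤ a i) {L M j l : ℕ} {w : List ℕ} (hl : l < L)
    {ρ : ℝ} (hρ : 0 < ρ)
    (h : ∀ᶠ n : ℕ in atTop, ρ * n ≤ ∑ i ∈ range n,
      (if PatternAt α L M (1 / ((j : ℝ) + 1)) (fun r => w.getD r 0) y l i then (1 : ℝ) else 0)) :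
    ∃ ρ' : ℝ, 0 < ρ' ∧ ∀ᶠ n : ℕ in atTop, ρ' * n ≤ ∑ i ∈ range n,
      (if PatternAt α L M (1 / ((j : ℝ) + 1)) (fun r => w.getD r 0) y (l + 1) i
        then (1 : ℝ) else 0) := by
  obtain ⟨C, hC0, hC⟩ := hA0.exists_observed_le
  set P : ℕ → ℕ → Prop := PatternAt α L M (1 / ((j : ℝ) + 1)) (fun r => w.getD r 0) y with hP
  set v := w.getD l 0 with hv
  -- On the pattern the observed conditional mean is at most `M' - 1`; from time `i₀` on, the true one
  -- exceeds it by less than `1`.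
  set M' : ℝ := C + (∑ r ∈ range L, (w.getD r 0 : ℝ) + M) + 1 with hM'
  set p : ℝ := Real.exp (-M') * c ^ v / (v.factorial : ℝ) with hp
  have hp0 : 0 < p := by positivity
  obtain ⟨i₀, hi₀⟩ := eventually_atTop.1
    (hT.observed_approx.eventually (gt_mem_nhds (one_pos : (0 : ℝ) < 1)))
  have hterm : ∀ i, p * (if P l i then (1 : ℝ) else 0) - p * (if i < i₀ then 1 else 0)
      ≤ (if P l i then (1 : ℝ) else 0) * poissonWeight (a i) v := by
    intro i
    have hw := poissonWeight_nonneg (hc.le.trans (hac i)) v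
    by_cases h1 : P l i
    · rw [if_pos h1, one_mul]
      by_cases h2 : i < i₀
      · rw [if_pos h2]
        linarith
      · rw [if_neg h2]
        have h3 := hi₀ i (not_lt.1 h2)
        have h4 := hC θs hθs y i
        have h5 := PatternAt.sum_le hA0 hl h1
        have h6 : a i ≤ M' := by linarith
        have := le_poissonWeight hc (hac i) h6 v
        linarith
    · rw [if_neg h1]
      split_ifs <;> linarith
  have hbase : ∀ n : ℕ, p * ∑ i ∈ range n, (if P l i then (1 : ℝ) else 0) - p * i₀
      ≤ ∑ i ∈ range n, (if P l i then (1 : ℝ) else 0) * poissonWeight (a i) v := by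
    intro n
    have h1 := sum_le_sum fun i (_ : i ∈ range n) => hterm i
    rw [sum_sub_distrib, ← mul_sum, ← mul_sum] at h1
    have h2 : ∑ i ∈ range n, (if i < i₀ then (1 : ℝ) else 0) ≤ i₀ := by
      rw [← sum_filter, sum_const, nsmul_eq_mul, mul_one]
      have h3 : #{i ∈ range n | i < i₀} ≤ #(range i₀) :=
        card_le_card fun i hi => mem_range.2 (mem_filter.1 hi).2
      rw [card_range] at h3
      exact_mod_cast h3
    have h3 := mul_le_mul_of_nonneg_left h2 hp0.le
    linarith
  have hε : 0 < p * ρ / 4 := by positivity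
  have hlln := eventually_abs_sum_le (hT.pattern L M j w l) hε
  obtain ⟨N, hN⟩ := exists_nat_gt (2 * i₀ / ρ + 1)
  refine ⟨p * ρ / 4, hε, ?_⟩
  obtain ⟨N₁, hN₁⟩ := eventually_atTop.1 ((h.and hlln).and (eventually_ge_atTop N))
  filter_upwards [eventually_ge_atTop (N₁ + 1)] with n' hn'
  obtain ⟨n, rfl⟩ : ∃ n, n' = n + 1 := ⟨n' - 1, by omega⟩
  obtain ⟨⟨g1, g2⟩, g3⟩ := hN₁ n (by omega)
  have e1 : ∑ i ∈ range n, (if P (l + 1) (i + 1) then (1 : ℝ) else 0)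
      = ∑ i ∈ range n, (if P l i then (1 : ℝ) else 0) * poissonWeight (a i) v
        + ∑ i ∈ range n, (if P l i then (1 : ℝ) else 0)
          * ((if y i = v then 1 else 0) - poissonWeight (a i) v) := by
    rw [← sum_add_distrib]
    refine sum_congr rfl fun i _ => ?_
    have h1 : P (l + 1) (i + 1) ↔ P l i ∧ y i = v := patternAt_succ_iff
    by_cases h2 : P l i <;> by_cases h3 : y i = v <;> simp [h1, h2, h3]
  have e2 : (0 : ℝ) ≤ if P (l + 1) 0 then (1 : ℝ) else 0 := by split_ifs <;> norm_num
  rw [sum_range_succ', e1]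
  have k1 := hbase n
  have k2 := neg_le_of_abs_le g2
  have k3 := mul_le_mul_of_nonneg_left g1 hp0.le
  have k4 : 2 * i₀ + ρ ≤ ρ * n := by
    have h1 : 2 * (i₀ : ℝ) / ρ + 1 ≤ n := hN.le.trans (by exact_mod_cast g3)
    rw [← sub_nonneg] at h1 ⊢
    have h2 := mul_nonneg hρ.le h1
    have h3 : ρ * (n - (2 * (i₀ : ℝ) / ρ + 1)) = ρ * n - (2 * i₀ + ρ) := by
      field_simp
    linarith
  have k5 := mul_le_mul_of_nonneg_left k4 hp0.le
  push_cast
  nlinarith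

open scoped Classical in
/-- Every finite word is spelled out by the observations with positive frequency, after a long
enough run of zeros for the older observations to have negligible influence. -/
lemma TypicalPath.exists_pattern_frequency (hT : TypicalPath f α θs y a)
    (hA0 : AssumptionA0 Θ f α) (hθs : θs ∈ Θ) (hc : 0 < c) (hac : ∀ i, c ≤ a i) (v : ℕ → ℕ) (m : ℕ)
    {δ : ℝ} (hδ : 0 < δ) :
    ∃ ρ : ℝ, 0 < ρ ∧ ∀ᶠ n : ℕ in atTop, ρ * n ≤ ∑ i ∈ range n,
      (if ∀ θ ∈ Θ, |(f θ (observed y i) : ℝ) - f θ (cutoff m fun j => (v j : ℝ≥0))| ≤ δ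
        then (1 : ℝ) else 0) := by
  obtain ⟨B, hB0, hB, -⟩ := hT.exists_sum_cube_le hA0 hθs fun i => hc.le.trans (hac i)
  have hB1 : ∀ n : ℕ, ∑ i ∈ range n, (y i : ℝ) ≤ B * n := fun n => by
    simpa using sum_pow_le_of_sum_cube_le hB one_ne_zero (by norm_num) n
  obtain ⟨j, hj⟩ := exists_nat_one_div_lt hδ
  obtain ⟨L, M, hmL, hLM⟩ := exists_sum_patternAt_zero_ge (y := y) hA0 hB0 hB1
    (by positivity : (0 : ℝ) < 1 / ((j : ℝ) + 1)) m
  -- In order of time: `L - m` zeros, followed by `v` read backwards.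
  set w : List ℕ := (List.range L).map fun r => if L - 1 - r < m then v (L - 1 - r) else 0 with hw
  have hwget : ∀ r < L, w.getD r 0 = if L - 1 - r < m then v (L - 1 - r) else 0 := by
    intro r hr
    simp [hw, hr]
  have hfreq : ∀ l ≤ L, ∃ ρ : ℝ, 0 < ρ ∧ ∀ᶠ n : ℕ in atTop, ρ * n ≤ ∑ i ∈ range n,
      (if PatternAt α L M (1 / ((j : ℝ) + 1)) (fun r => w.getD r 0) y l i
        then (1 : ℝ) else 0) := by
    intro l
    induction l with
    | zero =>
      intro _
      refine ⟨1 / 2, by norm_num, Eventually.of_forall fun n => ?_⟩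
      have := hLM (fun r => w.getD r 0) n
      linarith
    | succ l ih =>
      intro hl
      obtain ⟨ρ, hρ, h⟩ := ih (by omega)
      exact hT.pattern_frequency_succ hA0 hθs hc hac (by omega) hρ h
  obtain ⟨ρ, hρ, h⟩ := hfreq L le_rfl
  refine ⟨ρ, hρ, ?_⟩
  filter_upwards [h] with n hn
  refine hn.trans (sum_le_sum fun i _ => ?_)
  by_cases h1 : PatternAt α L M (1 / ((j : ℝ) + 1)) (fun r => w.getD r 0) y L i
  · rw [if_pos h1, if_pos]
    exact fun θ hθ => (h1.abs_sub_le hA0 hθ hmL hwget).trans hj.le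
  · rw [if_neg h1]
    split_ifs <;> norm_num

/-- The Kullback–Leibler divergence between the Poisson laws predicted at time `i` by the parameters
`θs` and `θ` from the observed past. -/
noncomputable def predictiveDiv (f : MeanFamily d) (y : ℕ → ℕ) (θs θ : EuclideanSpace ℝ (Fin d))
    (i : ℕ) : ℝ :=
  (f θs (observed y i) : ℝ) * (Real.log (f θs (observed y i)) - Real.log (f θ (observed y i)))
    - f θs (observed y i) + f θ (observed y i)

/-- Near any parameter other than the true one, the accumulated divergence grows linearly, at a
uniform rate. -/
lemma TypicalPath.exists_nhds_sum_predictiveDiv_ge (hT : TypicalPath f α θs y a)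
    (hA0 : AssumptionA0 Θ f α) (hθs : θs ∈ Θ) (hc : 0 < c) (hlow : ∀ θ ∈ Θ, ∀ x, c ≤ f θ x)
    (hac : ∀ i, c ≤ a i) (hcont : ∀ x : ℕ → ℝ≥0, ContinuousOn (fun θ => (f θ x : ℝ)) Θ)
    {θ₀ : EuclideanSpace ℝ (Fin d)} (hθ₀ : θ₀ ∈ Θ) {v : ℕ → ℕ} {m : ℕ}
    (hne : f θ₀ (cutoff m fun j => (v j : ℝ≥0)) ≠ f θs (cutoff m fun j => (v j : ℝ≥0))) :
    ∃ U ∈ 𝓝[Θ] θ₀, ∃ η : ℝ, 0 < η ∧ ∀ᶠ n : ℕ in atTop, ∀ θ ∈ Θ ∩ U,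
      η * n ≤ ∑ i ∈ range n, predictiveDiv f y θs θ i := by
  classical
  set x : ℕ → ℝ≥0 := cutoff m fun j => (v j : ℝ≥0) with hx
  set g : ℝ := |(f θ₀ x : ℝ) - f θs x| with hg
  have hg0 : 0 < g := abs_pos.2 (sub_ne_zero.2 fun h => hne (NNReal.coe_injective h))
  -- Three approximations, each up to `g / 4`, leave a difference of at least `g / 4`.
  set δ : ℝ := g / 4 with hδ
  have hδ0 : 0 < δ := by positivity
  obtain ⟨ρ, hρ, hfreq⟩ := hT.exists_pattern_frequency hA0 hθs hc hac v m hδ0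
  have hU : ∀ᶠ θ in 𝓝[Θ] θ₀, |(f θ x : ℝ) - f θ₀ x| < δ := by
    have := (hcont x θ₀ hθ₀).eventually (Metric.ball_mem_nhds _ hδ0)
    simpa [Real.dist_eq] using this
  set M : ℝ := f θ₀ x + f θs x + 2 * δ with hM
  have hM0 : 0 < M := by positivity
  refine ⟨_, hU, δ ^ 2 / (4 * M) * ρ, by positivity, ?_⟩
  filter_upwards [hfreq] with n hn θ hθ
  have hθU : |(f θ x : ℝ) - f θ₀ x| < δ := hθ.2
  have hterm : ∀ i, δ ^ 2 / (4 * M) * (if ∀ θ ∈ Θ, |(f θ (observed y i) : ℝ) - f θ x| ≤ δ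
      then (1 : ℝ) else 0) ≤ predictiveDiv f y θs θ i := by
    intro i
    have hb0 : (0 : ℝ) < f θ (observed y i) := hc.trans_le (hlow θ hθ.1 _)
    have hs0 : (0 : ℝ) < f θs (observed y i) := hc.trans_le (hlow θs hθs _)
    split_ifs with h
    · rw [mul_one]
      have h1 := abs_le.1 (h θ hθ.1)
      have h2 := abs_le.1 (h θs hθs)
      have h3 := abs_lt.1 hθU
      have n1 : (0 : ℝ) ≤ f θ₀ x := NNReal.coe_nonneg _
      have n2 : (0 : ℝ) ≤ f θs x := NNReal.coe_nonneg _
      refine le_poisson_klDiv hs0 hb0 (by linarith) (by linarith) hδ0.le ?_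
      have h4 : g ≤ |(f θs (observed y i) : ℝ) - f θ (observed y i)| + 3 * δ := by
        rw [hg]
        refine abs_le.2 ⟨?_, ?_⟩
        · linarith [le_abs_self ((f θs (observed y i) : ℝ) - f θ (observed y i))]
        · linarith [neg_abs_le ((f θs (observed y i) : ℝ) - f θ (observed y i))]
      linarith
    · rw [mul_zero]
      exact poisson_klDiv_nonneg hs0 hb0
  have h1 := sum_le_sum fun i (_ : i ∈ range n) => hterm i
  rw [← mul_sum] at h1
  refine le_trans ?_ h1
  rw [mul_assoc]
  exact mul_le_mul_of_nonneg_left hn (by positivity)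

end

/-! ### Consistency -/

section

variable {d : ℕ} {Θ : Set (EuclideanSpace ℝ (Fin d))} {f : MeanFamily d} {α : ℕ → ℝ≥0}
  {θs : EuclideanSpace ℝ (Fin d)} {y : ℕ → ℕ} {a : ℕ → ℝ} {c : ℝ}

/-- Away from the true parameter the accumulated divergence grows linearly, at a uniform rate. -/
lemma TypicalPath.exists_sum_predictiveDiv_ge (hT : TypicalPath f α θs y a)
    (hA0 : AssumptionA0 Θ f α) (hΘ : IsCompact Θ) (hθs : θs ∈ Θ) (hc : 0 < c)
    (hlow : ∀ θ ∈ Θ, ∀ x, c ≤ f θ x) (hac : ∀ i, c ≤ a i)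
    (hcont : ∀ x : ℕ → ℝ≥0, ContinuousOn (fun θ => (f θ x : ℝ)) Θ)
    (hword : ∀ θ ∈ Θ, θ ≠ θs → ∃ (v : ℕ → ℕ) (m : ℕ),
      f θ (cutoff m fun j => (v j : ℝ≥0)) ≠ f θs (cutoff m fun j => (v j : ℝ≥0)))
    {V : Set (EuclideanSpace ℝ (Fin d))} (hV : IsOpen V) (hθV : θs ∈ V) :
    ∃ η : ℝ, 0 < η ∧ ∀ᶠ n : ℕ in atTop, ∀ θ ∈ Θ \ V,
      η * n ≤ ∑ i ∈ range n, predictiveDiv f y θs θ i := by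
  refine (hΘ.diff hV).induction_on (p := fun S => ∃ η : ℝ, 0 < η ∧ ∀ᶠ n : ℕ in atTop,
    ∀ θ ∈ S, η * n ≤ ∑ i ∈ range n, predictiveDiv f y θs θ i) ?_ ?_ ?_ ?_
  · exact ⟨1, one_pos, Eventually.of_forall fun n θ hθ => absurd hθ (Set.notMem_empty θ)⟩
  · rintro S T hST ⟨η, hη, h⟩
    exact ⟨η, hη, h.mono fun n hn θ hθ => hn θ (hST hθ)⟩
  · rintro S T ⟨η, hη, h⟩ ⟨η', hη', h'⟩
    refine ⟨min η η', lt_min hη hη', ?_⟩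
    filter_upwards [h, h'] with n hn hn' θ hθ
    have hn0 : (0 : ℝ) ≤ n := Nat.cast_nonneg n
    rcases hθ with hθ | hθ
    · exact (mul_le_mul_of_nonneg_right (min_le_left _ _) hn0).trans (hn θ hθ)
    · exact (mul_le_mul_of_nonneg_right (min_le_right _ _) hn0).trans (hn' θ hθ)
  · intro θ₀ hθ₀
    have hne : θ₀ ≠ θs := fun h => hθ₀.2 (h ▸ hθV)
    obtain ⟨v, m, hvm⟩ := hword θ₀ hθ₀.1 hne
    obtain ⟨U, hU, η, hη, h⟩ :=
      hT.exists_nhds_sum_predictiveDiv_ge hA0 hθs hc hlow hac hcont hθ₀.1 hvm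
    exact ⟨Θ ∩ U, nhdsWithin_mono _ Set.sdiff_subset (inter_mem self_mem_nhdsWithin hU), η, hη, h⟩

/-- The conditional log-likelihood of the first `n` observations of the trajectory `y`. -/
noncomputable def pathLogLik (f : MeanFamily d) (y : ℕ → ℕ) (n : ℕ)
    (θ : EuclideanSpace ℝ (Fin d)) : ℝ :=
  ∑ i ∈ range n, ((y i : ℝ) * Real.log (f θ (observed y i)) - f θ (observed y i))

/-- Along a typical path, parameters outside a neighbourhood of the true one are eventually less
likely than the true one. The likelihood difference is the accumulated divergence, up to a
martingale part and an error due to the unobserved past, both negligible uniformly in the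
parameter. -/
theorem TypicalPath.eventually_pathLogLik_lt (hT : TypicalPath f α θs y a)
    (hA0 : AssumptionA0 Θ f α) (hΘ : IsCompact Θ) (hθs : θs ∈ Θ) (hc : 0 < c)
    (hlow : ∀ θ ∈ Θ, ∀ x, c ≤ f θ x) (hac : ∀ i, c ≤ a i)
    (hcont : ∀ x : ℕ → ℝ≥0, ContinuousOn (fun θ => (f θ x : ℝ)) Θ)
    (hword : ∀ θ ∈ Θ, θ ≠ θs → ∃ (v : ℕ → ℕ) (m : ℕ),
      f θ (cutoff m fun j => (v j : ℝ≥0)) ≠ f θs (cutoff m fun j => (v j : ℝ≥0)))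
    {V : Set (EuclideanSpace ℝ (Fin d))} (hV : IsOpen V) (hθV : θs ∈ V) :
    ∀ᶠ n : ℕ in atTop, ∀ θ ∈ Θ \ V, pathLogLik f y n θ < pathLogLik f y n θs := by
  obtain ⟨η, hη, hdiv⟩ :=
    hT.exists_sum_predictiveDiv_ge hA0 hΘ hθs hc hlow hac hcont hword hV hθV
  have ha0 : ∀ i, 0 ≤ a i := fun i => hc.le.trans (hac i)
  have hmart := hT.eventually_abs_sum_mul_log_le hA0 hθs ha0 hc hlow
    (by positivity : 0 < η / 8)
  obtain ⟨B, hB0, hB, -⟩ := hT.exists_sum_cube_le hA0 hθs ha0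
  obtain ⟨C, hC0, hC⟩ := hA0.exists_observed_le
  set G : ℕ → ℝ := fun i => |Real.log c| + (C + ∑ j ∈ range i, (α j : ℝ) * (y (i - 1 - j) : ℝ))
    with hG
  have hG0 : ∀ i, 0 ≤ G i := fun i => by positivity
  have hlogG : ∀ θ ∈ Θ, ∀ i, |Real.log (f θ (observed y i))| ≤ G i := fun θ hθ i =>
    (abs_log_le hc (hlow θ hθ _)).trans (add_le_add le_rfl (hC θ hθ y i))
  have hGB : ∀ n : ℕ, ∑ i ∈ range n, G i ≤ (|Real.log c| + (C + B)) * n := by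
    intro n
    have h1 := sum_convolution_le (β := fun j => (α j : ℝ)) (g := fun i => (y i : ℝ))
      (fun j => (α j).coe_nonneg) (fun i => Nat.cast_nonneg _) n
    have h2 : ∑ i ∈ range n, (y i : ℝ) ≤ B * n := by
      simpa using sum_pow_le_of_sum_cube_le hB one_ne_zero (by norm_num) n
    have h3 := mul_le_mul_of_nonneg_right (hA0.sum_le_one (range n))
      (sum_nonneg fun i (_ : i ∈ range n) => (Nat.cast_nonneg (y i) : (0 : ℝ) ≤ y i))
    simp only [hG, sum_add_distrib, sum_const, card_range, nsmul_eq_mul]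
    linarith
  have hinit := eventually_sum_abs_mul_le hT.observed_approx hG0 hGB
    (by positivity : 0 < η / 8)
  filter_upwards [hdiv, hmart, hinit, eventually_gt_atTop 0] with n g1 g2 g3 hn θ hθ
  have hn0 : (0 : ℝ) < n := by exact_mod_cast hn
  have hdecomp : pathLogLik f y n θs - pathLogLik f y n θ
      = (∑ i ∈ range n, ((y i : ℝ) - a i) * Real.log (f θs (observed y i))
        - ∑ i ∈ range n, ((y i : ℝ) - a i) * Real.log (f θ (observed y i)))
        + ∑ i ∈ range n, (a i - f θs (observed y i))
          * (Real.log (f θs (observed y i)) - Real.log (f θ (observed y i)))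
        + ∑ i ∈ range n, predictiveDiv f y θs θ i := by
    simp only [pathLogLik, predictiveDiv]
    rw [← sum_sub_distrib, ← sum_sub_distrib, ← sum_add_distrib, ← sum_add_distrib]
    exact sum_congr rfl fun i _ => by ring
  have h1 := abs_le.1 (g2 θs hθs)
  have h2 := abs_le.1 (g2 θ hθ.1)
  have h3 : |∑ i ∈ range n, (a i - f θs (observed y i))
      * (Real.log (f θs (observed y i)) - Real.log (f θ (observed y i)))| ≤ 2 * (η / 8 * n) := by
    refine (abs_sum_le_sum_abs _ _).trans ?_
    refine le_trans (sum_le_sum fun i _ => ?_)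
      ((mul_sum _ _ _).symm.le.trans (mul_le_mul_of_nonneg_left g3 zero_le_two))
    rw [abs_mul]
    have h4 := abs_sub (Real.log (f θs (observed y i))) (Real.log (f θ (observed y i)))
    have h5 := hlogG θs hθs i
    have h6 := hlogG θ hθ.1 i
    have h7 := mul_le_mul_of_nonneg_left (h4.trans (add_le_add h5 h6))
      (abs_nonneg (a i - f θs (observed y i)))
    linarith
  have h4 := abs_le.1 h3
  have h5 := g1 θ hθ
  have h6 : 0 < η * n := by positivity
  linarith

section Likelihood

variable {Ω : Type*} {Y : ℤ → Ω → ℕ} {k : ℤ}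

lemma logLikHat_eq_pathLogLik (n : ℕ) (θ : EuclideanSpace ℝ (Fin d)) (ω : Ω) :
    logLikHat Y k f (Finset.Icc (k + 1) (k + (n : ℤ))) θ ω
      = pathLogLik f (trajectory Y k ω) n θ := by
  unfold logLikHat pathLogLik
  refine sum_nbij' (fun t => (t - (k + 1)).toNat) (fun i => k + 1 + (i : ℤ)) ?_ ?_ ?_ ?_ ?_
  · intro t ht
    simp only [Finset.mem_Icc, mem_range] at ht ⊢
    omega
  · intro i hi
    simp only [Finset.mem_Icc, mem_range] at hi ⊢
    omega
  · intro t ht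
    simp only [Finset.mem_Icc] at ht
    omega
  · intro i _
    simp
  · intro t ht
    simp only [Finset.mem_Icc] at ht
    have e : k + 1 + ((t - (k + 1)).toNat : ℤ) = t := by omega
    have h1 := observedPast_eq_observed (Y := Y) (k := k) ω (t - (k + 1)).toNat
    rw [e] at h1
    simp only [lamHat, trajectory, h1, e]

/-- The likelihood is continuous on the compact parameter set, hence attains its maximum. -/
lemma mleSet_nonempty (hΘ : IsCompact Θ) (hne : Θ.Nonempty) (hc : 0 < c)
    (hlow : ∀ θ ∈ Θ, ∀ x, c ≤ f θ x)
    (hcont : ∀ x : ℕ → ℝ≥0, ContinuousOn (fun θ => (f θ x : ℝ)) Θ) (T : Finset ℤ) (ω : Ω) :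
    (mleSet Y k Θ f T ω).Nonempty := by
  have h1 : ContinuousOn (fun θ => logLikHat Y k f T θ ω) Θ := by
    refine continuousOn_finsetSum _ fun t _ => ?_
    have h2 := hcont (observedPast Y k t ω)
    exact (continuousOn_const.mul (h2.log fun θ hθ => (hc.trans_le (hlow θ hθ _)).ne')).sub h2
  obtain ⟨θ, hθ, hmax⟩ := hΘ.exists_isMaxOn hne h1
  exact ⟨θ, hθ, fun θ' hθ' => hmax hθ'⟩

end Likelihood

end

end PoissonAR

theorem theorem3p1 {d : ℕ} {Ω : Type*} [MeasurableSpace Ω]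
    (μ : MeasureTheory.Measure Ω) [MeasureTheory.IsProbabilityMeasure μ]
    (Y : ℤ → Ω → ℕ) (hY : ∀ t : ℤ, Measurable (Y t)) (k : ℤ)
    (Θ : Set (EuclideanSpace ℝ (Fin d))) (hΘ : IsCompact Θ)
    (f : PoissonAR.MeanFamily d)
    (hf_meas : ∀ θ ∈ Θ, Measurable (f θ))
    (hf_cont : ∀ y : ℕ → NNReal, ContinuousOn (fun θ => (f θ y : ℝ)) Θ)
    (θs : EuclideanSpace ℝ (Fin d)) (hθs : θs ∈ interior Θ)
    (hmodel : PoissonAR.IsPoissonARAfter μ Y k f θs)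
    (hmom : PoissonAR.BoundedPastMoments μ Y k)
    (hD : PoissonAR.AssumptionD Θ f)
    (hId : PoissonAR.AssumptionId μ Y k Θ f)
    (α : ℕ → NNReal) (hA0 : PoissonAR.AssumptionA0 Θ f α)
    (γ : ℝ) (hγ : 3 / 2 < γ)
    (hα : Asymptotics.IsBigO Filter.atTop (fun j : ℕ => (α j : ℝ))
      (fun j : ℕ => ((j : ℝ) + 1) ^ (-γ))) :
    (∀ (n : ℕ) (ω : Ω),
      (PoissonAR.mleSet Y k Θ f (Finset.Icc (k + 1) (k + (n : ℤ))) ω).Nonempty) ∧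
    ∀ θhat : ℕ → Ω → EuclideanSpace ℝ (Fin d),
      (∀ n : ℕ, ∀ᵐ ω ∂μ,
        θhat n ω ∈ PoissonAR.mleSet Y k Θ f (Finset.Icc (k + 1) (k + (n : ℤ))) ω) →
      ∀ᵐ ω ∂μ, Filter.Tendsto (fun n : ℕ => θhat n ω) Filter.atTop (nhds θs) := by
  have hθsΘ : θs ∈ Θ := interior_subset hθs
  obtain ⟨c, hc, hlow⟩ := hD
  have hc' : (0 : ℝ) < c := by exact_mod_cast hc
  have hlow' : ∀ θ ∈ Θ, ∀ x : ℕ → ℝ≥0, (c : ℝ) ≤ f θ x := fun θ hθ x => by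
    exact_mod_cast hlow θ hθ x
  refine ⟨fun n ω => PoissonAR.mleSet_nonempty hΘ ⟨θs, hθsΘ⟩ hc' hlow' hf_cont _ ω,
    fun θhat hθhat => ?_⟩
  have hword := fun θ (hθ : θ ∈ Θ) (hne : θ ≠ θs) =>
    PoissonAR.exists_word_ne hY hmom hA0 hId hθ hθsΘ hne
  filter_upwards [PoissonAR.ae_typicalPath hY (hf_meas θs hθsΘ) hθsΘ hmodel hmom hA0
    (by linarith : 1 < γ) hα, MeasureTheory.ae_all_iff.2 hθhat] with ω hT hmle
  rw [tendsto_nhds]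
  intro V hV hθV
  filter_upwards [hT.eventually_pathLogLik_lt hA0 hΘ hθsΘ hc' hlow' (fun i => hlow' θs hθsΘ _)
    hf_cont hword hV hθV] with n hn
  by_contra hout
  obtain ⟨hmem, hmax⟩ := hmle n
  have h1 := hmax θs hθsΘ
  rw [PoissonAR.logLikHat_eq_pathLogLik, PoissonAR.logLikHat_eq_pathLogLik] at h1
  exact absurd h1 (not_le.2 (hn _ ⟨hmem, hout⟩))
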